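/- **Notation.** Let $n,m\ge 1$ be integers and $p>1$. Identify $\mathbb R^{nm}$ with the $n\times m$ matrices, so that $y^t\xi\in\mathbb R^m$ for $y\in\mathbb R^{nm}$, $\xi\in\mathbb R^n$. Write $h_K(u)=\sup_{x\in K}\langle x,u\rangle$ for the support function of $K$, $\omega_n$ for the volume of the closed Euclidean unit ball $B_2^n$, and $d v$ for spherical Lebesgue measure on $\mathbb S^{n-1}$. Let $\mathcal C^{n,m}$ be the class of convex bodies $Q\subset\mathbb R^m$ with the origin in the interior such that, for every $y\in\mathbb R^{nm}$, the function $\xi\mapsto h_Q(y^t\xi)$ is $C^2$ on the open set $\{\xi\in\mathbb R^n: y^t\xi\neq 0\}$ (for instance, every such $Q$ with $h_Q\in C^2(\mathbb R^m\setminus\{0\})$). For a bounded open set $\Omega\subset\mathbb R^n$, $W_0^{1,p}(\Omega)$ is the closure of $C_c^\infty(\Omega)$ in $W^{1,p}(\mathbb R^n)$; its elements are regarded as functions on $\mathbb R^n$ that vanish outside $\Omega$, with weak gradient $\nabla f\in L^p(\mathbb R^n)$. Put $$\Pi^\circ_{Q,p}f=\Big\{\theta\in\mathbb R^{nm}:\int_{\mathbb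 R^n}h_Q(\theta^t\nabla f(x))^p\,dx\le 1\Big\},\qquad \Pi^\circ_{Q,p}B_2^n=\Big\{\theta\in\mathbb R^{nm}:\int_{\mathbb S^{n-1}}h_Q(\theta^t v)^p\,dv\le 1\Big\},$$ for $L\subset\mathbb R^{nm}$ of finite positive volume let $\Gamma_{Q,p}L\subset\mathbb R^n$ be the convex body with support function $$h_{\Gamma_{Q,p}L}(v)=\Big(\frac1{\mathrm{vol}_{nm}(L)}\int_L h_Q(x^tv)^p\,dx\Big)^{1/p},$$ and for $f\in W_0^{1,p}(\Omega)$, $f\ne 0$, let $$L_{Q,p,f}=\Big(\frac{m}{(nm+p)\,\omega_n}\Big)^{-\frac1p}\Big(\frac{\mathrm{vol}_{nm}(\Pi^\circ_{Q,p}B_2^n)}{\mathrm{vol}_{nm}(\Pi^\circ_{Q,p}f)}\Big)^{\frac1{nm}}\,\Gamma_{Q,p}\,\Pi^\circ_{Q,p}f ;$$ for $f=0$ put $L_{Q,p,0}=\{0\}$. The affine $m$th-order $p$-Laplace operator and the usual $p$-Laplacian are the distributions on $\mathbb R^n$ $$\Delta^{\mathcal A}_{Q,p}f=-\operatorname{div}\Big(\nabla\big(\tfrac1p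 h_{L_{Q,p,f}}^p\big)(\nabla f)\Big),\qquad \Delta_pf=-\operatorname{div}\big(|\nabla f|^{p-2}\nabla f\big),$$ where $-\operatorname{div}V$ acts on $\varphi\in C_c^\infty(\mathbb R^n)$ by $\varphi\mapsto\int_{\mathbb R^n}\langle V,\nabla\varphi\rangle\,dx$. For a distribution $T$ and $A\in SL(n)$, $T\circ A$ is the distribution $\varphi\mapsto T(\varphi\circ A^{-1})$. **Proposition.** Let $p>1$, $Q\in\mathcal C^{n,m}$, let $\Omega\subset\mathbb R^n$ be a bounded open set, and let $A\in SL(n)$, $f\in W_0^{1,p}(\Omega)$ and $a>0$. Then $\frac1p h_{L_{Q,p,f}}^p$ is differentiable on $\mathbb R^n$ and $\nabla(\frac1p h_{L_{Q,p,f}}^p)(\nabla f)\in L^{p/(p-1)}(\mathbb R^n)$, so that $\Delta^{\mathcal A}_{Q,p}f$ is well defined, and: (a) $f\circ A\in W_0^{1,p}(A^{-1}\Omega)$ and $\Delta^{\mathcal A}_{Q,p}(f\circ A)=(\Delta^{\mathcal A}_{Q,p}f)\circ A$; (b) $af\in W_0^{1,p}(\Omega)$ and $\Delta^{\mathcal A}_{Q,p}(af)=a^{p-1}\Delta^{\mathcal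 A}_{Q,p}f$; (c) if $f$ is radial, i.e. $f(x)=F(|x|)$ for almost every $x\in\mathbb R^n$ and some $F$, then $\Delta^{\mathcal A}_{Q,p}f=\Delta_pf$ in $\mathbb R^n$. -/

import Mathlib

open MeasureTheory TopologicalSpace
open scoped Distributions Pointwise InnerProductSpace

noncomputable section

namespace AffineLap

/-- Euclidean space `ℝⁿ`. -/
abbrev E (n : ℕ) := EuclideanSpace ℝ (Fin n)

/-- `ℝ^{nm}`: the `n × m` matrices with the Euclidean (Frobenius) structure and Lebesgue measure. -/
abbrev Mat (n m : ℕ) := EuclideanSpace ℝ (Fin n × Fin m)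

/-- The vector `yᵗξ ∈ ℝᵐ` for an `n × m` matrix `y` and `ξ ∈ ℝⁿ`. -/
def tmul {n m : ℕ} (y : Mat n m) (ξ : E n) : E m :=
  WithLp.toLp 2 fun j => ∑ i, y (i, j) * ξ i

/-- The support function `h_K(u) = sup_{y ∈ K} ⟨y, u⟩`. -/
def supportFn {k : ℕ} (K : Set (E k)) (u : E k) : ℝ :=
  sSup ((fun y => ⟪y, u⟫_ℝ) '' K)

/-- The closed convex set whose support function is the (sublinear) function `s`. -/
def bodyOfSupport {k : ℕ} (s : E k → ℝ) : Set (E k) :=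
  {x | ∀ v, ⟪x, v⟫_ℝ ≤ s v}

/-- The class `𝒞^{n,m}`: convex bodies `Q ⊆ ℝᵐ` with the origin in the interior such that, for each
`y ∈ ℝ^{nm}`, the function `ξ ↦ h_Q(yᵗξ)` is `C²` away from the `ξ` with `yᵗξ = 0` (where it
is not differentiable, unless `y = 0`). Every `Q` whose support function is
`C²` on `ℝᵐ ∖ {0}` belongs to it. -/
structure IsSmoothBody (n : ℕ) {m : ℕ} (Q : ConvexBody (E m)) : Prop where
  zero_mem_interior : (0 : E m) ∈ interior (Q : Set (E m))
  contDiffOn : ∀ y : Mat n m,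
    ContDiffOn ℝ 2 (fun ξ : E n => supportFn (Q : Set (E m)) (tmul y ξ)) {ξ | tmul y ξ ≠ 0}

/-! ### Sobolev functions -/

/-- `G` is the weak gradient of `f` on `ℝⁿ`. -/
structure HasWeakGradient {n : ℕ} (f : E n → ℝ) (G : E n → E n) : Prop where
  locallyIntegrable : LocallyIntegrable f volume
  locallyIntegrable_grad : LocallyIntegrable G volume
  integral_eq : ∀ φ : 𝓓((⊤ : Opens (E n)), ℝ),
    ∫ x, f x • gradient (fun z => φ z) x = -∫ x, φ x • G x

open scoped Classical in
/-- The weak gradient `∇f` (unique up to null sets); `0` if there is none. -/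
def weakGrad {n : ℕ} (f : E n → ℝ) : E n → E n :=
  if h : ∃ G, HasWeakGradient f G then h.choose else 0

/-- `f ∈ W₀^{1,p}(Ω)`, for `f` extended by zero to `ℝⁿ`: `f` is a limit of functions in `C_c^∞(Ω)`,
in `L^p` together with the gradients. -/
structure MemW0 {n : ℕ} (Ω : Opens (E n)) (p : ℝ) (f : E n → ℝ) : Prop where
  memLp : MemLp f (ENNReal.ofReal p) volume
  exists_grad : ∃ G : E n → E n, HasWeakGradient f G ∧ MemLp G (ENNReal.ofReal p) volume ∧
    ∃ φ : ℕ → 𝓓(Ω, ℝ),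
      Filter.Tendsto (fun k => eLpNorm (fun x => φ k x - f x) (ENNReal.ofReal p) volume)
        Filter.atTop (nhds 0) ∧
      Filter.Tendsto
        (fun k => eLpNorm (fun x => gradient (fun z => φ k z) x - G x) (ENNReal.ofReal p) volume)
        Filter.atTop (nhds 0)

/-! ### The bodies `Π°_{Q,p} B`, `Π°_{Q,p} f`, `Γ_{Q,p} L` and `L_{Q,p,f}` -/

section bodies

variable {n m : ℕ}

/-- The gauge of `Π°_{Q,p} B` for the Euclidean unit ball `B` of `ℝⁿ`, whose `L^p` surface area
measure is the spherical Lebesgue measure. -/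
def gaugePolarBall (n : ℕ) (Q : ConvexBody (E m)) (p : ℝ) (θ : Mat n m) : ℝ :=
  (∫ v : Metric.sphere (0 : E n) 1,
    supportFn (Q : Set (E m)) (tmul θ v) ^ p ∂(volume : Measure (E n)).toSphere) ^ (1 / p)

/-- The polar projection body `Π°_{Q,p} B ⊆ ℝ^{nm}` of the Euclidean unit ball `B` of `ℝⁿ`. -/
def polarBall (n : ℕ) (Q : ConvexBody (E m)) (p : ℝ) : Set (Mat n m) :=
  {θ | gaugePolarBall n Q p θ ≤ 1}

/-- The gauge `‖h_Q(θᵗ∇f(·))‖_{L^p(ℝⁿ)}` of `Π°_{Q,p} f`. -/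
def gaugePolarFun (Q : ConvexBody (E m)) (p : ℝ) (f : E n → ℝ) (θ : Mat n m) : ℝ :=
  (∫ x, supportFn (Q : Set (E m)) (tmul θ (weakGrad f x)) ^ p) ^ (1 / p)

/-- The polar projection body `Π°_{Q,p} f ⊆ ℝ^{nm}` of a function. -/
def polarFun (Q : ConvexBody (E m)) (p : ℝ) (f : E n → ℝ) : Set (Mat n m) :=
  {θ | gaugePolarFun Q p f θ ≤ 1}

/-- The centroid body `Γ_{Q,p} L ⊆ ℝⁿ` of `L ⊆ ℝ^{nm}`, given by its support function
`v ↦ (|L|⁻¹ ∫_L h_Q(xᵗv)^p dx)^{1/p}`. -/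
def centroidBody (Q : ConvexBody (E m)) (p : ℝ) (L : Set (Mat n m)) : Set (E n) :=
  bodyOfSupport fun v =>
    ((volume.real L)⁻¹ * ∫ x in L, supportFn (Q : Set (E m)) (tmul x v) ^ p) ^ (1 / p)

/-- The body `L_{Q,p,f} = (m / ((nm + p) ω_n))^{-1/p} (|Π°B| / |Π°f|)^{1/(nm)} Γ_{Q,p} Π°_{Q,p} f`.
For `f = 0` a.e. the conventions for division by zero make it `{0}`. -/
def bodyL (Q : ConvexBody (E m)) (p : ℝ) (f : E n → ℝ) : Set (E n) :=
  ((m / ((n * m + p) * volume.real (Metric.closedBall (0 : E n) 1))) ^ (-(1 / p)) *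
    (volume.real (polarBall n Q p) / volume.real (polarFun Q p f)) ^ (1 / (n * m : ℝ))) •
      centroidBody Q p (polarFun Q p f)

end bodies

/-! ### The operators -/

section operators

variable {n m : ℕ}

/-- The distribution `-div V` on `ℝⁿ`: `φ ↦ ∫ ⟨V, ∇φ⟩ dx` (for `V` locally integrable). -/
def negDiv (V : E n → E n) : 𝓓'((⊤ : Opens (E n)), ℝ) :=
  (TestFunction.integralAgainstBilinCLM (Ω := (⊤ : Opens (E n))) (n := ⊤)
    (ContinuousLinearMap.id ℝ (E n →L[ℝ] ℝ)) volume V).comp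
      (TestFunction.fderivCLM ℝ ⊤ ⊤)

/-- `-div V` acts on test functions by `φ ↦ ∫ ⟨V, ∇φ⟩ dx`. -/
theorem negDiv_apply {V : E n → E n} (hV : LocallyIntegrable V volume)
    (φ : 𝓓((⊤ : Opens (E n)), ℝ)) :
    negDiv V φ = ∫ x, ⟪V x, gradient (fun z => φ z) x⟫_ℝ := by
  change TestFunction.integralAgainstBilinCLM _ volume V (TestFunction.fderivCLM ℝ ⊤ ⊤ φ) = _
  rw [TestFunction.integralAgainstBilinCLM_eq_integral (hV.locallyIntegrableOn _)]
  refine integral_congr_ae (Filter.Eventually.of_forall fun x => ?_)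
  simp only [TestFunction.fderivCLM_apply, ContinuousLinearMap.coe_id', id_eq]
  rw [real_inner_comm, gradient, InnerProductSpace.toDual_symm_apply]
  simp

/-- The vector field `∇(h_K^p / p)`. -/
def wulffField (p : ℝ) (K : Set (E n)) (z : E n) : E n :=
  gradient (fun w => 1 / p * supportFn K w ^ p) z

/-- The Wulff `p`-Laplacian `Δ_{p,K} f = -div(∇(h_K^p / p)(∇f))`. -/
def wulffLaplacian (p : ℝ) (K : Set (E n)) (f : E n → ℝ) : 𝓓'((⊤ : Opens (E n)), ℝ) :=
  negDiv fun x => wulffField p K (weakGrad f x)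

/-- The affine `m`th-order `p`-Laplace operator `Δ^𝒜_{Q,p} f = Δ_{p, L_{Q,p,f}} f`. -/
def affineLaplacian (Q : ConvexBody (E m)) (p : ℝ) (f : E n → ℝ) :
    𝓓'((⊤ : Opens (E n)), ℝ) :=
  wulffLaplacian p (bodyL Q p f) f

/-- The usual `p`-Laplacian `Δ_p f = -div(|∇f|^{p-2} ∇f)`. -/
def pLaplacian (p : ℝ) (f : E n → ℝ) : 𝓓'((⊤ : Opens (E n)), ℝ) :=
  negDiv fun x => ‖weakGrad f x‖ ^ (p - 2) • weakGrad f x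

/-- The linear map `x ↦ Ax` of `ℝⁿ` for `A ∈ SL(n)`. -/
def slMap (A : Matrix.SpecialLinearGroup (Fin n) ℝ) : E n →L[ℝ] E n :=
  Matrix.toEuclideanCLM (n := Fin n) (𝕜 := ℝ) (A : Matrix (Fin n) (Fin n) ℝ)

theorem slMap_mul_apply (A B : Matrix.SpecialLinearGroup (Fin n) ℝ) (x : E n) :
    slMap (A * B) x = slMap A (slMap B x) := by
  simp [slMap]

theorem slMap_inv_apply (A : Matrix.SpecialLinearGroup (Fin n) ℝ) (x : E n) :
    slMap A⁻¹ (slMap A x) = x := by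
  rw [← slMap_mul_apply]
  simp [slMap]

theorem slMap_apply_inv (A : Matrix.SpecialLinearGroup (Fin n) ℝ) (x : E n) :
    slMap A (slMap A⁻¹ x) = x := by
  rw [← slMap_mul_apply]
  simp [slMap]

/-- `x ↦ Ax` as a homeomorphism. -/
def slHomeo (A : Matrix.SpecialLinearGroup (Fin n) ℝ) : E n ≃ₜ E n where
  toFun := slMap A
  invFun := slMap A⁻¹
  left_inv := slMap_inv_apply A
  right_inv := slMap_apply_inv A
  continuous_toFun := (slMap A).continuous
  continuous_invFun := (slMap A⁻¹).continuous

/-- The open set `A⁻¹(Ω) = {x | Ax ∈ Ω}`. -/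
def slPreimage (A : Matrix.SpecialLinearGroup (Fin n) ℝ) (Ω : Opens (E n)) : Opens (E n) :=
  ⟨slMap A ⁻¹' Ω, Ω.isOpen.preimage (slMap A).continuous⟩

/-- The test function `φ ∘ A`. -/
def testComp (φ : 𝓓((⊤ : Opens (E n)), ℝ)) (A : Matrix.SpecialLinearGroup (Fin n) ℝ) :
    𝓓((⊤ : Opens (E n)), ℝ) where
  toFun x := φ (slMap A x)
  contDiff' := φ.contDiff.comp (slMap A).contDiff
  hasCompactSupport' := φ.hasCompactSupport.comp_homeomorph (slHomeo A)
  tsupport_subset' := fun _ _ => trivial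

/-- The composition `T ∘ A` of a distribution `T` with `A ∈ SL(n)`: since `det A = 1`, it is
`φ ↦ T (φ ∘ A⁻¹)`, which for a locally integrable function `T` is `x ↦ T (Ax)`. -/
def distComp (T : 𝓓'((⊤ : Opens (E n)), ℝ)) (A : Matrix.SpecialLinearGroup (Fin n) ℝ)
    (φ : 𝓓((⊤ : Opens (E n)), ℝ)) : ℝ :=
  T (testComp φ A⁻¹)

end operators

end AffineLap

end

open MeasureTheory TopologicalSpace
open scoped Distributions Pointwise InnerProductSpace

noncomputable section

namespace AffineLap

/-! ### Weak gradients and linear changes of variables -/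

section weakGradient

variable {n : ℕ}

/-! Regularity. The potential h_L^p / p of L = L_{Q,p,f} is a constant multiple of the moment v ↦ ∫
h_Q(xᵗv)^p dx over Π°f (`potential_bodyL`), so it can be differentiated under the integral sign. For
fixed x the integrand is differentiable at every v: where xᵗv ≠ 0 by smoothness of Q, where xᵗv = 0
because the power p > 1 removes the kink. A local Lipschitz bound gives a gradient of size
O(|z|^(p-1)), which places the field in L^{p/(p-1)}. This needs Π°f bounded for f ≠ 0. By
compactness it is enough that its gauge is positive off the origin; a zero would give w ≠ 0 with ⟨w,
∇f⟩ = 0 a.e., which is impossible for a nonzero function vanishing off a bounded set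
(`MemW0.ae_eq_zero_of_inner_weakGrad`). For f = 0 the set Π°f is everything, its real-valued volume
is 0 by convention, and the potential vanishes.

Parts (a) and (b) are changes of variables. For T in SL(n), Π°(f ∘ T) is the preimage of Π°f under θ
↦ Tθ, which preserves volume on matrices; hence L_{f∘T} = T⁻¹ L_f, and this cancels the factor Tᵗ in
∇(f ∘ T). For a > 0, Π°(af) = a⁻¹ Π°f and the volume ratio in the normalisation makes L_{af} = L_f,
so only the (p-1)-homogeneity of the field is left.

Part (c). If f is radial, ∇f commutes a.e. with rotations, so the law of its direction, weighted by
|∇f|^p, is a rotation invariant measure on the sphere, hence proportional to the spherical one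
(`integral_eq_of_invariant`). Thus Π°f is a dilate of Π°B. The moment is then K|v|^p, and K is found
by integrating over the sphere and applying Fubini together with `setIntegral_rpow_of_homogeneous`.
The constants in L_{Q,p,f} are exactly those that turn it into the unit ball
(`supportFn_bodyL_of_invariant`). -/

/-- The adjoint of a continuous linear equivalence, as an equivalence. -/
def adjEquiv (T : E n ≃L[ℝ] E n) : E n ≃L[ℝ] E n :=
  ContinuousLinearEquiv.equivOfInverse (ContinuousLinearMap.adjoint (T : E n →L[ℝ] E n))
    (ContinuousLinearMap.adjoint (T.symm : E n →L[ℝ] E n))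
    (fun x => ext_inner_right ℝ fun y => by
      simp [ContinuousLinearMap.adjoint_inner_left])
    (fun x => ext_inner_right ℝ fun y => by
      simp [ContinuousLinearMap.adjoint_inner_left])

theorem inner_adjEquiv_left (T : E n ≃L[ℝ] E n) (x y : E n) :
    ⟪adjEquiv T x, y⟫_ℝ = ⟪x, T y⟫_ℝ :=
  ContinuousLinearMap.adjoint_inner_left (T : E n →L[ℝ] E n) y x

theorem inner_adjEquiv_right (T : E n ≃L[ℝ] E n) (x y : E n) :
    ⟪x, adjEquiv T y⟫_ℝ = ⟪T x, y⟫_ℝ :=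
  ContinuousLinearMap.adjoint_inner_right (T : E n →L[ℝ] E n) x y

theorem gradient_comp_equiv (T : E n ≃L[ℝ] E n) (φ : E n → ℝ) (x : E n) :
    gradient (fun z => φ (T z)) x = adjEquiv T (gradient φ (T x)) := by
  refine ext_inner_right ℝ fun y => ?_
  rw [inner_adjEquiv_left, gradient, gradient, InnerProductSpace.toDual_symm_apply,
    InnerProductSpace.toDual_symm_apply]
  have := T.comp_right_fderiv (f := φ) (x := x)
  simp only [Function.comp_def] at this
  rw [this]
  rfl

theorem gradient_const_mul (c : ℝ) (φ : E n → ℝ) (x : E n) :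
    gradient (fun z => c * φ z) x = c • gradient φ x := by
  rw [gradient, gradient]
  have := congrFun (fderiv_const_smul_field (𝕜 := ℝ) (f := φ) c) x
  simp only [Pi.smul_apply, Pi.smul_def, smul_eq_mul] at this
  rw [this, map_smul]

/-- Composition of a test function with a linear equivalence. -/
def testCompEquiv (T : E n ≃L[ℝ] E n) {Ω Ω' : Opens (E n)} (h : ∀ x, T x ∈ Ω → x ∈ Ω')
    (φ : 𝓓(Ω, ℝ)) : 𝓓(Ω', ℝ) where
  toFun x := φ (T x)
  contDiff' := φ.contDiff.comp T.contDiff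
  hasCompactSupport' := φ.hasCompactSupport.comp_homeomorph T.toHomeomorph
  tsupport_subset' := fun x hx => h x (φ.tsupport_subset
    (tsupport_comp_subset_preimage φ T.continuous hx))

/-- By the fundamental lemma of the calculus of variations, the choice made in `weakGrad` matters
only on a null set. -/
theorem HasWeakGradient.ae_eq {f : E n → ℝ} {G G' : E n → E n} (h : HasWeakGradient f G)
    (h' : HasWeakGradient f G') : G =ᵐ[volume] G' := by
  refine ae_eq_of_integral_contDiff_smul_eq h.locallyIntegrable_grad h'.locallyIntegrable_grad
    fun g hg hgc => ?_
  let φ : 𝓓((⊤ : Opens (E n)), ℝ) := ⟨g, hg, hgc, fun _ _ => trivial⟩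
  have h1 := h.integral_eq φ
  rw [h'.integral_eq φ, neg_inj] at h1
  exact h1.symm

theorem HasWeakGradient.weakGrad_ae_eq {f : E n → ℝ} {G : E n → E n} (h : HasWeakGradient f G) :
    weakGrad f =ᵐ[volume] G := by
  have hex : ∃ G, HasWeakGradient f G := ⟨G, h⟩
  rw [weakGrad, dif_pos hex]
  exact hex.choose_spec.ae_eq h

theorem HasWeakGradient.congr {f f' : E n → ℝ} {G : E n → E n} (h : HasWeakGradient f G)
    (hff : f =ᵐ[volume] f') : HasWeakGradient f' G where
  locallyIntegrable := h.locallyIntegrable.congr hff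
  locallyIntegrable_grad := h.locallyIntegrable_grad
  integral_eq φ := by
    rw [← h.integral_eq φ]
    refine integral_congr_ae ?_
    filter_upwards [hff] with x hx
    rw [hx]

theorem HasWeakGradient.const_mul {f : E n → ℝ} {G : E n → E n} (h : HasWeakGradient f G)
    (c : ℝ) : HasWeakGradient (fun x => c * f x) (fun x => c • G x) where
  locallyIntegrable := h.locallyIntegrable.smul c
  locallyIntegrable_grad := h.locallyIntegrable_grad.smul c
  integral_eq φ := by
    have := h.integral_eq φ
    simp_rw [mul_smul, smul_comm (φ _) c, integral_smul, this, smul_neg]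

theorem LocallyIntegrable.comp_equiv {F : Type*} [NormedAddCommGroup F] {f : E n → F}
    (h : LocallyIntegrable f volume) (T : E n ≃L[ℝ] E n)
    (hT : MeasurePreserving T volume volume) :
    LocallyIntegrable (fun x => f (T x)) volume := by
  rw [locallyIntegrable_iff] at h ⊢
  intro k hk
  have := h _ (hk.image T.continuous)
  rw [← hT.integrableOn_comp_preimage T.toHomeomorph.measurableEmbedding] at this
  rwa [T.injective.preimage_image] at this

/-- Test against φ ∘ T⁻¹ and change variables; no Jacobian appears because T preserves volume. -/
theorem HasWeakGradient.comp_equiv {f : E n → ℝ} {G : E n → E n} (h : HasWeakGradient f G)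
    (T : E n ≃L[ℝ] E n) (hT : MeasurePreserving T volume volume) :
    HasWeakGradient (fun x => f (T x)) (fun x => adjEquiv T (G (T x))) where
  locallyIntegrable := LocallyIntegrable.comp_equiv h.locallyIntegrable T hT
  locallyIntegrable_grad := by
    have h1 := LocallyIntegrable.comp_equiv h.locallyIntegrable_grad T hT
    rw [locallyIntegrable_iff] at h1 ⊢
    exact fun k hk => (adjEquiv T : E n →L[ℝ] E n).integrable_comp (h1 k hk)
  integral_eq φ := by
    let ψ : 𝓓((⊤ : Opens (E n)), ℝ) := testCompEquiv T.symm (fun _ _ => trivial) φ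
    have hφ : ∀ x, φ x = ψ (T x) := fun x => by
      change φ x = φ (T.symm (T x))
      rw [T.symm_apply_apply]
    have hemb := T.toHomeomorph.measurableEmbedding
    have h1 := h.integral_eq ψ
    simp_rw [hφ, gradient_comp_equiv T (fun z => ψ z), ← map_smul]
    rw [(adjEquiv T).integral_comp_comm, (adjEquiv T).integral_comp_comm,
      hT.integral_comp hemb (fun y => f y • gradient (fun z => ψ z) y),
      hT.integral_comp hemb (fun y => ψ y • G y), h1, map_neg]

end weakGradient

/-! ### The space `W₀^{1,p}` -/

section sobolev

variable {n : ℕ}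

theorem MemW0.hasWeakGradient {Ω : Opens (E n)} {p : ℝ} {f : E n → ℝ} (hf : MemW0 Ω p f) :
    HasWeakGradient f (weakGrad f) := by
  obtain ⟨G, hG, -⟩ := hf.exists_grad
  have hex : ∃ G, HasWeakGradient f G := ⟨G, hG⟩
  rw [weakGrad, dif_pos hex]
  exact hex.choose_spec

theorem MemW0.memLp_weakGrad {Ω : Opens (E n)} {p : ℝ} {f : E n → ℝ} (hf : MemW0 Ω p f) :
    MemLp (weakGrad f) (ENNReal.ofReal p) volume := by
  obtain ⟨G, hG, hGp, -⟩ := hf.exists_grad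
  exact hGp.ae_eq hG.weakGrad_ae_eq.symm

theorem MemW0.comp_equiv {Ω Ω' : Opens (E n)} {p : ℝ} {f : E n → ℝ} (hf : MemW0 Ω p f)
    (T : E n ≃L[ℝ] E n) (hT : MeasurePreserving T volume volume)
    (hΩ : ∀ x, T x ∈ Ω → x ∈ Ω') : MemW0 Ω' p (fun x => f (T x)) where
  memLp := hf.memLp.comp_measurePreserving hT
  exists_grad := by
    obtain ⟨G, hG, hGp, φ, hφ, hφG⟩ := hf.exists_grad
    refine ⟨_, hG.comp_equiv T hT, ?_, fun k => testCompEquiv T hΩ (φ k), ?_, ?_⟩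
    · exact (adjEquiv T : E n →L[ℝ] E n).comp_memLp' (hGp.comp_measurePreserving hT)
    · refine hφ.congr fun k => ?_
      exact (eLpNorm_comp_measurePreserving
        ((φ k).continuous.aestronglyMeasurable.sub hf.memLp.1) hT).symm
    · have hφm : ∀ k, AEStronglyMeasurable
          (fun x => gradient (fun z => φ k z) x - G x) volume := fun k => by
        refine AEStronglyMeasurable.sub ?_ hGp.1
        have : Continuous (fun x => gradient (fun z => φ k z) x) :=
          (InnerProductSpace.toDual ℝ (E n)).symm.continuous.comp
            ((φ k).contDiff.continuous_fderiv (by simp))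
        exact this.aestronglyMeasurable
      -- The adjoint is bounded, so it distorts the gradient error by at most its operator norm.
      have hlim : Filter.Tendsto (fun k => ENNReal.ofReal ‖(adjEquiv T : E n →L[ℝ] E n)‖ *
          eLpNorm (fun x => gradient (fun z => φ k z) x - G x) (ENNReal.ofReal p) volume)
          Filter.atTop (nhds 0) := by
        have := ENNReal.Tendsto.const_mul (a := ENNReal.ofReal ‖(adjEquiv T : E n →L[ℝ] E n)‖)
          hφG (Or.inr ENNReal.ofReal_ne_top)
        rwa [mul_zero] at this
      refine tendsto_of_tendsto_of_tendsto_of_le_of_le tendsto_const_nhds hlim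
        (fun _ => zero_le) fun k => ?_
      rw [← eLpNorm_comp_measurePreserving (hφm k) hT]
      refine eLpNorm_le_mul_eLpNorm_of_ae_le_mul (Filter.Eventually.of_forall fun x => ?_) _
      have : gradient (fun z => testCompEquiv T hΩ (φ k) z) x =
          adjEquiv T (gradient (fun z => φ k z) (T x)) :=
        gradient_comp_equiv T (fun z => φ k z) x
      rw [this, ← map_sub]
      exact (adjEquiv T : E n →L[ℝ] E n).le_opNorm _

theorem MemW0.const_mul {Ω : Opens (E n)} {p : ℝ} {f : E n → ℝ} (hf : MemW0 Ω p f) (c : ℝ) :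
    MemW0 Ω p (fun x => c * f x) where
  memLp := hf.memLp.const_mul c
  exists_grad := by
    obtain ⟨G, hG, hGp, φ, hφ, hφG⟩ := hf.exists_grad
    have key : ∀ {F : Type} [NormedAddCommGroup F] [NormedSpace ℝ F] (u : ℕ → E n → F),
        Filter.Tendsto (fun k => eLpNorm (u k) (ENNReal.ofReal p) volume) Filter.atTop (nhds 0) →
        Filter.Tendsto (fun k => eLpNorm (c • u k) (ENNReal.ofReal p) volume)
          Filter.atTop (nhds 0) := fun u hu => by
      have := ENNReal.Tendsto.const_mul (a := ‖c‖ₑ) hu (Or.inr enorm_ne_top)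
      rw [mul_zero] at this
      exact this.congr fun k => (eLpNorm_const_smul _ _ _ _).symm
    refine ⟨_, hG.const_mul c, hGp.const_smul c, fun k => c • φ k, ?_, ?_⟩
    · refine (key _ hφ).congr fun k => ?_
      congr 1
      ext x
      simp [mul_sub]
    · refine (key _ hφG).congr fun k => ?_
      congr 1
      ext1 x
      have : gradient (fun z => (c • φ k) z) x = c • gradient (fun z => φ k z) x :=
        gradient_const_mul c (fun z => φ k z) x
      rw [this, ← smul_sub]
      rfl

/-- The approximants vanish off Ω, so the norm of f there is at most its distance to each of them.
-/
theorem MemW0.ae_eq_zero_of_notMem {Ω : Opens (E n)} {p : ℝ} {f : E n → ℝ} (hp : 1 < p)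
    (hf : MemW0 Ω p f) : ∀ᵐ x, x ∉ Ω → f x = 0 := by
  obtain ⟨G, hG, hGp, φ, hφ, hφG⟩ := hf.exists_grad
  have hp0 : ENNReal.ofReal p ≠ 0 := by simp; linarith
  have h1 : eLpNorm f (ENNReal.ofReal p) (volume.restrict (Ω : Set (E n))ᶜ) = 0 := by
    refine le_antisymm (ge_of_tendsto' hφ fun k => ?_) zero_le
    refine le_trans (le_of_eq ?_) (eLpNorm_mono_measure _
      (Measure.restrict_le_self (s := (Ω : Set (E n))ᶜ)))
    rw [← eLpNorm_neg]
    refine eLpNorm_congr_ae ?_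
    filter_upwards [ae_restrict_mem Ω.isOpen.measurableSet.compl] with x hx
    have : φ k x = 0 := image_eq_zero_of_notMem_tsupport fun h => hx ((φ k).tsupport_subset h)
    simp [this]
  rw [eLpNorm_eq_zero_iff hf.memLp.1.restrict hp0] at h1
  exact (ae_restrict_iff' Ω.isOpen.measurableSet.compl).1 h1

end sobolev

/-! ### Vanishing directional derivatives -/

section directional

variable {n : ℕ}

theorem MemW0.integrable {Ω : Opens (E n)} {p : ℝ} {f : E n → ℝ} (hp : 1 < p)
    (hΩ : Bornology.IsBounded (Ω : Set (E n))) (hf : MemW0 Ω p f) : Integrable f volume := by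
  have hfin : IsFiniteMeasure (volume.restrict (Ω : Set (E n))) :=
    ⟨by rw [Measure.restrict_apply_univ]; exact hΩ.measure_lt_top⟩
  have h1 : IntegrableOn f (Ω : Set (E n)) volume :=
    (hf.memLp.restrict _).integrable (by rw [← ENNReal.ofReal_one]; gcongr)
  exact h1.integrable_of_ae_notMem_eq_zero (hf.ae_eq_zero_of_notMem hp)

/-- A function of `W₀^{1,p}` of a bounded set with a vanishing directional derivative vanishes:
`t ↦ ∫ f(x) g(x + t w) dx` is constant for each test function `g`, and zero for large `t`. -/
theorem MemW0.ae_eq_zero_of_inner_weakGrad {Ω : Opens (E n)} {p : ℝ} {f : E n → ℝ} (hp : 1 < p)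
    (hΩ : Bornology.IsBounded (Ω : Set (E n))) (hf : MemW0 Ω p f) {w : E n} (hw : w ≠ 0)
    (h : ∀ᵐ x, ⟪w, weakGrad f x⟫_ℝ = 0) : ∀ᵐ x, f x = 0 := by
  have hfi := hf.integrable hp hΩ
  have hG := hf.hasWeakGradient
  refine ae_eq_zero_of_integral_contDiff_smul_eq_zero hfi.locallyIntegrable fun g hg hgc => ?_
  have hshift : ∀ t : ℝ, ContDiff ℝ (⊤ : ℕ∞) (fun x : E n => g (x + t • w)) := fun t =>
    hg.comp (contDiff_id.add contDiff_const)
  have hshiftc : ∀ t : ℝ, HasCompactSupport (fun x : E n => g (x + t • w)) := fun t =>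
    hgc.comp_homeomorph (Homeomorph.addRight (t • w))
  have hdc : Continuous (fderiv ℝ g) := hg.continuous_fderiv (by simp)
  obtain ⟨C, hC⟩ := hdc.bounded_above_of_compact_support (hgc.fderiv ℝ)
  obtain ⟨D, hD⟩ := hg.continuous.bounded_above_of_compact_support hgc
  -- The weak gradient identity, tested with a translate of g and paired with w.
  have hzero : ∀ t : ℝ, ∫ x, f x * fderiv ℝ g (x + t • w) w = 0 := fun t => by
    let φ : 𝓓((⊤ : Opens (E n)), ℝ) := ⟨_, hshift t, hshiftc t, fun _ _ => trivial⟩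
    have h1 := hG.integral_eq φ
    have hφc : Continuous (fun x => gradient (fun z => φ z) x) :=
      (InnerProductSpace.toDual ℝ (E n)).symm.continuous.comp
        (φ.contDiff.continuous_fderiv (by simp))
    have hi1 : Integrable (fun x => f x • gradient (fun z => φ z) x) volume := by
      refine hfi.locallyIntegrable.integrable_smul_right_of_hasCompactSupport hφc ?_
      exact (φ.hasCompactSupport.fderiv ℝ).comp_left
        (g := (InnerProductSpace.toDual ℝ (E n)).symm) (map_zero _)
    have hi2 : Integrable (fun x => φ x • weakGrad f x) volume :=
      hG.locallyIntegrable_grad.integrable_smul_left_of_hasCompactSupport φ.continuous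
        φ.hasCompactSupport
    have h2 := congrArg (fun v => ⟪w, v⟫_ℝ) h1
    simp only [inner_neg_right] at h2
    rw [← integral_inner hi1, ← integral_inner hi2] at h2
    have h3 : ∫ x, ⟪w, φ x • weakGrad f x⟫_ℝ = 0 := by
      refine integral_eq_zero_of_ae ?_
      filter_upwards [h] with x hx
      simp [inner_smul_right, hx]
    rw [h3, neg_zero] at h2
    rw [← h2]
    refine integral_congr_ae (Filter.Eventually.of_forall fun x => ?_)
    simp only [inner_smul_right]
    congr 1
    rw [real_inner_comm, gradient, InnerProductSpace.toDual_symm_apply]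
    have : fderiv ℝ (fun z => φ z) x = fderiv ℝ g (x + t • w) :=
      fderiv_comp_add_right (f := g) (x := x) (t • w)
    rw [this]
  have hderiv : ∀ t : ℝ, HasDerivAt (fun t : ℝ => ∫ x, f x * g (x + t • w)) 0 t := fun t => by
    rw [← hzero t]
    refine (hasDerivAt_integral_of_dominated_loc_of_deriv_le (s := Set.univ)
      (F := fun t x => f x * g (x + t • w)) (F' := fun t x => f x * fderiv ℝ g (x + t • w) w)
      (bound := fun x => |f x| * (C * ‖w‖)) Filter.univ_mem ?_ ?_ ?_ ?_ ?_ ?_).2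
    · exact Filter.Eventually.of_forall fun s =>
        hfi.1.mul (hshift s).continuous.aestronglyMeasurable
    · exact hfi.mul_bdd (c := D) (hshift t).continuous.aestronglyMeasurable
        (Filter.Eventually.of_forall fun x => hD _)
    · refine hfi.1.mul (Continuous.aestronglyMeasurable ?_)
      exact (hdc.comp (continuous_id.add continuous_const)).clm_apply continuous_const
    · refine Filter.Eventually.of_forall fun x s _ => ?_
      rw [norm_mul, Real.norm_eq_abs]
      gcongr
      exact ((fderiv ℝ g _).le_opNorm w).trans (by gcongr; exact hC _)
    · exact hfi.abs.mul_const _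
    · refine Filter.Eventually.of_forall fun x s _ => HasDerivAt.const_mul _ ?_
      have h1 : HasDerivAt (fun s : ℝ => x + s • w) w s := by
        simpa using ((hasDerivAt_id s).smul_const w).const_add x
      exact ((hg.differentiable (by simp)) (x + s • w)).hasFDerivAt.comp_hasDerivAt s h1
  have hconst : ∀ t : ℝ, ∫ x, f x * g (x + t • w) = ∫ x, f x * g (x + (0 : ℝ) • w) := fun t =>
    is_const_of_deriv_eq_zero (fun s => (hderiv s).differentiableAt)
      (fun s => (hderiv s).deriv) t 0
  obtain ⟨R, hR⟩ := hΩ.exists_norm_le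
  obtain ⟨R', hR'⟩ := hgc.isBounded.exists_norm_le
  have hw' : 0 < ‖w‖ := norm_pos_iff.2 hw
  -- A translation of length |R| + |R'| + 1 separates Ω from the support of g.
  have hlarge : ∫ x, f x * g (x + ((|R| + |R'| + 1) / ‖w‖) • w) = 0 := by
    refine integral_eq_zero_of_ae ?_
    filter_upwards [hf.ae_eq_zero_of_notMem hp] with x hx
    by_cases hxΩ : x ∈ Ω
    · have : g (x + ((|R| + |R'| + 1) / ‖w‖) • w) = 0 := by
        refine image_eq_zero_of_notMem_tsupport fun hmem => ?_
        have h1 := hR' _ hmem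
        have h2 := hR x hxΩ
        have h3 : ‖((|R| + |R'| + 1) / ‖w‖) • w‖ = |R| + |R'| + 1 := by
          rw [norm_smul, Real.norm_of_nonneg (by positivity)]
          field_simp
        have h4 := norm_sub_le (x + ((|R| + |R'| + 1) / ‖w‖) • w) x
        rw [add_sub_cancel_left, h3] at h4
        linarith [le_abs_self R, le_abs_self R']
      simp [this]
    · simp [hx hxΩ]
  rw [hconst] at hlarge
  simpa [mul_comm] using hlarge

end directional

/-! ### Sublinear functions and support functions -/

section sublinear

/-- Subadditive, positively homogeneous functions. -/
structure IsSublinear {V : Type*} [AddCommGroup V] [Module ℝ V] (s : V → ℝ) : Prop where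
  add_le : ∀ u v, s (u + v) ≤ s u + s v
  smul : ∀ (c : ℝ) (v : V), 0 ≤ c → s (c • v) = c * s v

theorem IsSublinear.map_zero {V : Type*} [AddCommGroup V] [Module ℝ V] {s : V → ℝ}
    (hs : IsSublinear s) : s 0 = 0 := by
  simpa using hs.smul 0 0 le_rfl

variable {k : ℕ}

theorem supportFn_smul (c : ℝ) (hc : 0 ≤ c) (K : Set (E k)) (v : E k) :
    supportFn (c • K) v = c * supportFn K v := by
  rw [supportFn, supportFn, ← smul_eq_mul, ← Real.sSup_smul_of_nonneg hc]
  congr 1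
  ext t
  simp only [Set.mem_image, Set.mem_smul_set]
  constructor
  · rintro ⟨_, ⟨y, hy, rfl⟩, rfl⟩
    exact ⟨_, ⟨y, hy, rfl⟩, by simp [inner_smul_left]⟩
  · rintro ⟨_, ⟨y, hy, rfl⟩, rfl⟩
    exact ⟨_, ⟨y, hy, rfl⟩, by simp [inner_smul_left]⟩

/-- A sublinear function is the support function of its body. -/
theorem supportFn_bodyOfSupport {s : E k → ℝ} (hs : IsSublinear s) (v : E k) :
    supportFn (bodyOfSupport s) v = s v := by
  have hub : ∀ y ∈ bodyOfSupport s, ⟪y, v⟫_ℝ ≤ s v := fun y hy => hy v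
  have hexists : ∃ y ∈ bodyOfSupport s, ⟪y, v⟫_ℝ = s v := by
    -- Hahn–Banach: extend c • v ↦ c * s v from the line spanned by v, dominated by s. The case v =
    -- 0 starts from the trivial subspace, since `mkSpanSingleton` needs a nonzero vector.
    obtain ⟨g, hg1, hg2⟩ : ∃ g : E k →ₗ[ℝ] ℝ, g v = s v ∧ ∀ x, g x ≤ s x := by
      by_cases hv : v = 0
      · obtain ⟨g, -, hg⟩ := exists_extension_of_le_sublinear
          (⟨⊥, 0⟩ : E k →ₗ.[ℝ] ℝ) s (fun c hc x => hs.smul c x hc.le) hs.add_le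
          (fun x => by
            have : (x : E k) = 0 := (Submodule.mem_bot ℝ).1 x.2
            rw [this, hs.map_zero]
            simp)
        exact ⟨g, by rw [hv, map_zero, hs.map_zero], hg⟩
      · have happ : ∀ (c : ℝ) (h : c • v ∈ (LinearPMap.mkSpanSingleton v (s v) hv).domain),
            LinearPMap.mkSpanSingleton v (s v) hv ⟨c • v, h⟩ = c * s v := fun c h =>
          LinearPMap.mkSpanSingleton'_apply (σ := RingHom.id ℝ) _ _ _ c h
        obtain ⟨g, hg', hg⟩ := exists_extension_of_le_sublinear
          (LinearPMap.mkSpanSingleton v (s v) hv) s (fun c hc x => hs.smul c x hc.le) hs.add_le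
          (fun x => by
            obtain ⟨x, hx⟩ := x
            obtain ⟨c, rfl⟩ := Submodule.mem_span_singleton.1 hx
            rw [happ c hx]
            rcases le_total 0 c with hc | hc
            · exact (hs.smul c v hc).ge
            -- For negative c, domination on the line comes from 0 = s(cv + (-c)v) ≤ s(cv) +
            -- s((-c)v).
            · have h1 := hs.smul (-c) v (by linarith)
              have h2 := hs.add_le (c • v) ((-c) • v)
              rw [← add_smul, add_neg_cancel, zero_smul, hs.map_zero, h1] at h2
              change _ ≤ s (c • v)
              linarith)
        refine ⟨g, ?_, hg⟩
        have := (hg' ⟨(1 : ℝ) • v, Submodule.mem_span_singleton.2 ⟨1, rfl⟩⟩).trans (happ 1 _)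
        simpa using this
    refine ⟨(InnerProductSpace.toDual ℝ (E k)).symm (LinearMap.toContinuousLinearMap g),
      fun w => ?_, ?_⟩
    · rw [InnerProductSpace.toDual_symm_apply]
      exact hg2 w
    · rw [InnerProductSpace.toDual_symm_apply]
      exact hg1
  obtain ⟨y, hy, hyv⟩ := hexists
  refine le_antisymm (csSup_le ⟨_, y, hy, rfl⟩ ?_) (le_csSup ⟨s v, ?_⟩ ⟨y, hy, hyv⟩)
  · rintro _ ⟨z, hz, rfl⟩
    exact hub z hz
  · rintro _ ⟨z, hz, rfl⟩
    exact hub z hz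

theorem bddAbove_inner_convexBody (Q : ConvexBody (E k)) (u : E k) :
    BddAbove ((fun y => ⟪y, u⟫_ℝ) '' (Q : Set (E k))) :=
  (Q.isCompact.image (by fun_prop)).bddAbove

theorem isSublinear_supportFn (Q : ConvexBody (E k)) :
    IsSublinear (supportFn (Q : Set (E k))) where
  add_le u v := by
    refine csSup_le (Q.nonempty.image _) ?_
    rintro _ ⟨y, hy, rfl⟩
    simp only [inner_add_right]
    exact add_le_add (le_csSup (bddAbove_inner_convexBody Q u) ⟨y, hy, rfl⟩)
      (le_csSup (bddAbove_inner_convexBody Q v) ⟨y, hy, rfl⟩)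
  smul c v hc := by
    rw [supportFn, supportFn, ← smul_eq_mul, ← Real.sSup_smul_of_nonneg hc]
    congr 1
    ext t
    simp [Set.mem_smul_set, inner_smul_right]

/-- A sublinear function comparable to the norm. -/
structure IsNormLike {V : Type*} [NormedAddCommGroup V] [Module ℝ V] (s : V → ℝ)
    (r R : ℝ) : Prop extends IsSublinear s where
  pos : 0 < r
  nonneg : 0 ≤ R
  le : ∀ u, r * ‖u‖ ≤ s u
  ge : ∀ u, s u ≤ R * ‖u‖

/-- A ball about the origin inside Q bounds its support function below, and a ball containing Q
bounds it above. -/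
theorem exists_isNormLike_supportFn {Q : ConvexBody (E k)}
    (hQ : (0 : E k) ∈ interior (Q : Set (E k))) :
    ∃ r R, IsNormLike (supportFn (Q : Set (E k))) r R := by
  obtain ⟨ε, hε, hball⟩ := Metric.mem_nhds_iff.1 (mem_interior_iff_mem_nhds.1 hQ)
  obtain ⟨R, hR⟩ := Q.isCompact.isBounded.exists_norm_le
  have hR0 : 0 ≤ R := by simpa using hR 0 (interior_subset hQ)
  refine ⟨ε / 2, R, ⟨isSublinear_supportFn Q, half_pos hε, hR0, fun u => ?_, fun u => ?_⟩⟩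
  · by_cases hu : u = 0
    · rw [hu, (isSublinear_supportFn Q).map_zero]
      simp
    have hu' : ‖u‖ ≠ 0 := norm_ne_zero_iff.2 hu
    have hmem : (ε / 2 / ‖u‖) • u ∈ (Q : Set (E k)) := by
      refine hball ?_
      rw [mem_ball_zero_iff, norm_smul, Real.norm_of_nonneg (by positivity)]
      field_simp
      linarith
    refine le_trans (le_of_eq ?_) (le_csSup (bddAbove_inner_convexBody Q u) ⟨_, hmem, rfl⟩)
    simp only [inner_smul_left, real_inner_self_eq_norm_sq]
    simp
    field_simp
  · refine csSup_le (Q.nonempty.image _) ?_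
    rintro _ ⟨y, hy, rfl⟩
    exact (real_inner_le_norm y u).trans (by gcongr; exact hR y hy)

namespace IsNormLike

variable {V : Type*} [NormedAddCommGroup V] [NormedSpace ℝ V] {s : V → ℝ} {r R : ℝ}

theorem apply_nonneg (hs : IsNormLike s r R) (u : V) : 0 ≤ s u :=
  (mul_nonneg hs.pos.le (norm_nonneg u)).trans (hs.le u)

theorem eq_zero (hs : IsNormLike s r R) {u : V} (h : s u = 0) : u = 0 := by
  have h1 := hs.le u
  rw [h] at h1
  have h2 := nonpos_of_mul_nonpos_right h1 hs.pos
  exact norm_le_zero_iff.1 h2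

theorem abs_sub_le (hs : IsNormLike s r R) (u v : V) : |s u - s v| ≤ R * ‖u - v‖ := by
  have h : ∀ u v, s u - s v ≤ R * ‖u - v‖ := fun u v => by
    have h1 := hs.add_le (u - v) v
    rw [sub_add_cancel] at h1
    linarith [hs.ge (u - v)]
  rw [abs_sub_le_iff]
  exact ⟨h u v, by rw [norm_sub_rev]; exact h v u⟩

theorem continuous (hs : IsNormLike s r R) : Continuous s := by
  refine (LipschitzWith.of_dist_le_mul (K := ⟨R, hs.nonneg⟩) fun u v => ?_).continuous
  rw [Real.dist_eq, dist_eq_norm]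
  exact hs.abs_sub_le u v

end IsNormLike

theorem abs_rpow_sub_rpow_le {p a b M : ℝ} (hp : 1 ≤ p) (ha : 0 ≤ a) (hb : 0 ≤ b) (haM : a ≤ M)
    (hbM : b ≤ M) : |a ^ p - b ^ p| ≤ p * M ^ (p - 1) * |a - b| := by
  refine (convex_Icc 0 M).norm_image_sub_le_of_norm_hasDerivWithin_le (f := fun x => x ^ p)
    (f' := fun x => p * x ^ (p - 1)) (fun x _ => (Real.hasDerivAt_rpow_const
      (Or.inr hp)).hasDerivWithinAt) (fun x hx => ?_) ⟨hb, hbM⟩ ⟨ha, haM⟩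
  rw [Real.norm_of_nonneg (mul_nonneg (by linarith) (Real.rpow_nonneg hx.1 _))]
  exact mul_le_mul_of_nonneg_left (Real.rpow_le_rpow hx.1 hx.2 (by linarith)) (by linarith)

end sublinear

/-! ### The bilinear map (y, ξ) ↦ yᵗξ -/

section tmul

variable {n m : ℕ}

theorem norm_tmul_le (y : Mat n m) (ξ : E n) : ‖tmul y ξ‖ ≤ ‖y‖ * ‖ξ‖ := by
  refine le_of_sq_le_sq ?_ (by positivity)
  rw [mul_pow, EuclideanSpace.real_norm_sq_eq, EuclideanSpace.real_norm_sq_eq,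
    EuclideanSpace.real_norm_sq_eq, Fintype.sum_prod_type_right, Finset.sum_mul]
  exact Finset.sum_le_sum fun j _ =>
    Finset.sum_mul_sq_le_sq_mul_sq Finset.univ (fun i => y (i, j)) (fun i => ξ i)

/-- The bilinear map `(y, ξ) ↦ yᵗ ξ`. -/
def tmulCLM (n m : ℕ) : Mat n m →L[ℝ] E n →L[ℝ] E m :=
  LinearMap.mkContinuous₂ (LinearMap.mk₂ ℝ tmul
    (fun y z ξ => by ext j; simp [tmul, add_mul, Finset.sum_add_distrib])
    (fun c y ξ => by ext j; simp [tmul, Finset.mul_sum, mul_assoc])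
    (fun y ξ η => by ext j; simp [tmul, mul_add, Finset.sum_add_distrib])
    (fun c y ξ => by ext j; simp [tmul, Finset.mul_sum, mul_left_comm])) 1
    (fun y ξ => by rw [one_mul]; exact norm_tmul_le y ξ)

theorem tmulCLM_apply (y : Mat n m) (ξ : E n) : tmulCLM n m y ξ = tmul y ξ := rfl

end tmul

/-! ### The functions `v ↦ ∫ h(F(x) v)^p dμ(x)` -/

section powerIntegral

variable {V W X : Type*} [NormedAddCommGroup V] [NormedSpace ℝ V] [NormedAddCommGroup W]
  [NormedSpace ℝ W] [MeasurableSpace X]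

/-- The function `v ↦ ∫ h(F(x) v)^p dμ(x)` for a field `F` of linear maps. -/
def powInt (h : W → ℝ) (p : ℝ) (μ : Measure X) (F : X → V →L[ℝ] W) (v : V) : ℝ :=
  ∫ x, h (F x v) ^ p ∂μ

variable {h : W → ℝ} {r R p : ℝ} {μ : Measure X} {F : X → V →L[ℝ] W}

theorem powInt_nonneg (hh : IsNormLike h r R) (v : V) : 0 ≤ powInt h p μ F v :=
  integral_nonneg fun _ => Real.rpow_nonneg (hh.apply_nonneg _) _

theorem powInt_smul (hh : IsNormLike h r R) {c : ℝ} (hc : 0 ≤ c) (v : V) :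
    powInt h p μ F (c • v) = c ^ p * powInt h p μ F v := by
  rw [powInt, powInt, ← integral_const_mul]
  congr 1
  ext x
  rw [map_smul, hh.smul _ _ hc, Real.mul_rpow hc (hh.apply_nonneg _)]

theorem integrable_norm_rpow (hp : 1 < p) (hF : MemLp F (ENNReal.ofReal p) μ) :
    Integrable (fun x => ‖F x‖ ^ p) μ := by
  have := hF.integrable_norm_rpow (by simp; linarith) ENNReal.ofReal_ne_top
  rwa [ENNReal.toReal_ofReal (by linarith)] at this

theorem aestronglyMeasurable_clm_apply (hF : MemLp F (ENNReal.ofReal p) μ) (v : V) :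
    AEStronglyMeasurable (fun x => F x v) μ :=
  (ContinuousLinearMap.apply ℝ W v).continuous.comp_aestronglyMeasurable hF.1

theorem aestronglyMeasurable_rpow_apply (hh : IsNormLike h r R) (hp : 1 < p)
    (hF : MemLp F (ENNReal.ofReal p) μ) (v : V) :
    AEStronglyMeasurable (fun x => h (F x v) ^ p) μ :=
  (hh.continuous.rpow_const fun _ => Or.inr (by linarith)).comp_aestronglyMeasurable
    (aestronglyMeasurable_clm_apply hF v)

theorem apply_le_mul (hh : IsNormLike h r R) (T : V →L[ℝ] W) {v : V} {M : ℝ} (hv : ‖v‖ ≤ M) :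
    h (T v) ≤ R * (‖T‖ * M) :=
  (hh.ge _).trans (mul_le_mul_of_nonneg_left
    ((T.le_opNorm v).trans (mul_le_mul_of_nonneg_left hv (norm_nonneg _))) hh.nonneg)

theorem rpow_apply_le (hh : IsNormLike h r R) (hp : 1 < p) (T : V →L[ℝ] W) {v : V} {M : ℝ}
    (hv : ‖v‖ ≤ M) : h (T v) ^ p ≤ (R * M) ^ p * ‖T‖ ^ p := by
  have hM : 0 ≤ M := (norm_nonneg v).trans hv
  rw [← Real.mul_rpow (mul_nonneg hh.nonneg hM) (norm_nonneg _)]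
  refine Real.rpow_le_rpow (hh.apply_nonneg _) ((apply_le_mul hh T hv).trans (le_of_eq ?_))
    (by linarith)
  ring

theorem integrable_rpow_apply (hh : IsNormLike h r R) (hp : 1 < p)
    (hF : MemLp F (ENNReal.ofReal p) μ) (v : V) : Integrable (fun x => h (F x v) ^ p) μ := by
  refine ((integrable_norm_rpow hp hF).const_mul ((R * ‖v‖) ^ p)).mono'
    (aestronglyMeasurable_rpow_apply hh hp hF v) (Filter.Eventually.of_forall fun x => ?_)
  rw [Real.norm_of_nonneg (Real.rpow_nonneg (hh.apply_nonneg _) _)]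
  exact rpow_apply_le hh hp (F x) le_rfl

/-- The Lipschitz constant is a multiple of ‖T‖^p, integrable once T = F x with F in L^p. This one
bound yields continuity of `powInt`, domination of its difference quotients and the growth of its
derivative. -/
theorem abs_rpow_apply_sub_le (hh : IsNormLike h r R) (hp : 1 < p) (T : V →L[ℝ] W) {v w : V}
    {M : ℝ} (hv : ‖v‖ ≤ M) (hw : ‖w‖ ≤ M) :
    |h (T v) ^ p - h (T w) ^ p| ≤ p * R ^ p * M ^ (p - 1) * ‖T‖ ^ p * ‖v - w‖ := by
  have hM : 0 ≤ M := (norm_nonneg v).trans hv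
  have h1 := abs_rpow_sub_rpow_le hp.le (hh.apply_nonneg (T v)) (hh.apply_nonneg (T w))
    (apply_le_mul hh T hv) (apply_le_mul hh T hw)
  have h2 : |h (T v) - h (T w)| ≤ R * (‖T‖ * ‖v - w‖) := by
    refine (hh.abs_sub_le _ _).trans (mul_le_mul_of_nonneg_left ?_ hh.nonneg)
    rw [← map_sub T]
    exact T.le_opNorm _
  have hR : R ^ p = R ^ (p - 1) * R := by
    rw [← Real.rpow_add_one' hh.nonneg (by linarith), sub_add_cancel]
  have hT : ‖T‖ ^ p = ‖T‖ ^ (p - 1) * ‖T‖ := by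
    rw [← Real.rpow_add_one' (norm_nonneg _) (by linarith), sub_add_cancel]
  refine h1.trans ((mul_le_mul_of_nonneg_left h2 ?_).trans (le_of_eq ?_))
  · have := hh.nonneg
    positivity
  · rw [Real.mul_rpow hh.nonneg (by positivity), Real.mul_rpow (norm_nonneg _) hM, hR, hT]
    ring

theorem abs_powInt_sub_le (hh : IsNormLike h r R) (hp : 1 < p)
    (hF : MemLp F (ENNReal.ofReal p) μ) {v w : V} {M : ℝ} (hv : ‖v‖ ≤ M) (hw : ‖w‖ ≤ M) :
    |powInt h p μ F v - powInt h p μ F w| ≤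
      p * R ^ p * (∫ x, ‖F x‖ ^ p ∂μ) * M ^ (p - 1) * ‖v - w‖ := by
  rw [powInt, powInt, ← integral_sub (integrable_rpow_apply hh hp hF v)
    (integrable_rpow_apply hh hp hF w), ← Real.norm_eq_abs]
  refine (norm_integral_le_of_norm_le
    ((integrable_norm_rpow hp hF).const_mul (p * R ^ p * M ^ (p - 1) * ‖v - w‖))
    (Filter.Eventually.of_forall fun x => ?_)).trans (le_of_eq ?_)
  · refine (abs_rpow_apply_sub_le hh hp (F x) hv hw).trans (le_of_eq ?_)
    ring
  · rw [integral_const_mul]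
    ring

theorem continuous_powInt (hh : IsNormLike h r R) (hp : 1 < p)
    (hF : MemLp F (ENNReal.ofReal p) μ) : Continuous (powInt h p μ F) := by
  refine continuous_iff_continuousAt.2 fun v => ?_
  refine continuousAt_of_locally_lipschitz (r := 1) one_pos
    (p * R ^ p * (∫ x, ‖F x‖ ^ p ∂μ) * (‖v‖ + 1) ^ (p - 1)) fun w hw => ?_
  rw [Real.dist_eq, dist_eq_norm]
  rw [dist_eq_norm] at hw
  refine abs_powInt_sub_le hh hp hF ?_ (by linarith)
  have := norm_add_le (w - v) v
  rw [sub_add_cancel] at this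
  linarith

/-- The `p`-th root of `powInt` is sublinear, by Minkowski's inequality. -/
theorem isSublinear_powInt_rpow (hh : IsNormLike h r R) (hp : 1 < p)
    (hF : MemLp F (ENNReal.ofReal p) μ) :
    IsSublinear fun v => powInt h p μ F v ^ (1 / p) where
  smul c v hc := by
    rw [powInt_smul hh hc, Real.mul_rpow (Real.rpow_nonneg hc _) (powInt_nonneg hh v),
      ← Real.rpow_mul hc, mul_one_div_cancel (by linarith), Real.rpow_one]
  add_le u v := by
    have hp0 : 0 < p := by linarith
    have hpe : ENNReal.ofReal p ≠ 0 := by simpa using hp0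
    have hmeas : ∀ v, AEStronglyMeasurable (fun x => h (F x v)) μ := fun v =>
      hh.continuous.comp_aestronglyMeasurable (aestronglyMeasurable_clm_apply hF v)
    have hmem : ∀ v, MemLp (fun x => h (F x v)) (ENNReal.ofReal p) μ := fun v => by
      rw [← integrable_norm_rpow_iff (hmeas v) hpe ENNReal.ofReal_ne_top,
        ENNReal.toReal_ofReal hp0.le]
      refine (integrable_rpow_apply hh hp hF v).congr (Filter.Eventually.of_forall fun x => ?_)
      simp only [Real.norm_of_nonneg (hh.apply_nonneg (F x v))]
    have key : ∀ v, powInt h p μ F v ^ (1 / p) =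
        (eLpNorm (fun x => h (F x v)) (ENNReal.ofReal p) μ).toReal := fun v => by
      rw [(hmem v).eLpNorm_eq_integral_rpow_norm hpe ENNReal.ofReal_ne_top,
        ENNReal.toReal_ofReal hp0.le, ENNReal.toReal_ofReal
          (Real.rpow_nonneg (integral_nonneg fun x => Real.rpow_nonneg (norm_nonneg _) _) _),
        powInt, one_div]
      simp only [Real.norm_of_nonneg (hh.apply_nonneg _)]
    simp only [key]
    rw [← ENNReal.toReal_add (hmem u).2.ne (hmem v).2.ne]
    refine ENNReal.toReal_mono (ENNReal.add_ne_top.2 ⟨(hmem u).2.ne, (hmem v).2.ne⟩) ?_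
    refine le_trans (eLpNorm_mono_real
      (g := (fun x => h (F x u)) + fun x => h (F x v)) fun x => ?_)
      (eLpNorm_add_le (hmeas u) (hmeas v) (by rw [← ENNReal.ofReal_one]; gcongr))
    rw [Real.norm_of_nonneg (hh.apply_nonneg _), map_add]
    exact hh.add_le _ _

/-- On the kernel of T the function is O(‖w - v‖^p) = o(‖w - v‖), as p > 1, so the derivative there
is zero; elsewhere the chain rule applies. -/
theorem differentiableAt_rpow_apply (hh : IsNormLike h r R) (hp : 1 < p) {T : V →L[ℝ] W}
    (hT : ∀ v, T v ≠ 0 → DifferentiableAt ℝ (fun v => h (T v)) v) (v : V) :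
    DifferentiableAt ℝ (fun v => h (T v) ^ p) v := by
  by_cases hv : T v = 0
  · have hbound : ∀ w, ‖h (T w) ^ p - h (T v) ^ p‖ ≤ (R * ‖T‖) ^ p * ‖w - v‖ ^ p := fun w => by
      have h0 : h (T v) = 0 := by rw [hv, hh.map_zero]
      have hw : T w = T (w - v) := by rw [map_sub, hv, sub_zero]
      rw [h0, Real.zero_rpow (by linarith), sub_zero, hw,
        Real.norm_of_nonneg (Real.rpow_nonneg (hh.apply_nonneg _) _)]
      refine (rpow_apply_le hh hp T le_rfl).trans (le_of_eq ?_)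
      rw [← Real.mul_rpow (mul_nonneg hh.nonneg (norm_nonneg _)) (norm_nonneg _),
        ← Real.mul_rpow (mul_nonneg hh.nonneg (norm_nonneg _)) (norm_nonneg _)]
      ring_nf
    refine (HasFDerivAt.of_isLittleO (f' := (0 : V →L[ℝ] ℝ)) ?_).differentiableAt
    have h1 : (fun w => h (T w) ^ p - h (T v) ^ p - (0 : V →L[ℝ] ℝ) (w - v)) =O[nhds v]
        fun w => ‖w - v‖ ^ p := by
      refine Asymptotics.IsBigO.of_bound ((R * ‖T‖) ^ p) (Filter.Eventually.of_forall fun w => ?_)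
      rw [Real.norm_of_nonneg (Real.rpow_nonneg (norm_nonneg _) p)]
      simpa using hbound w
    refine h1.trans_isLittleO ?_
    rw [← Asymptotics.isLittleO_norm_right]
    have h2 : (fun t : ℝ => t ^ p) =o[nhdsWithin 0 (Set.Ici 0)] fun t => t := by
      refine Asymptotics.isLittleO_of_tendsto' (Filter.Eventually.of_forall fun t ht => by
        rw [ht, Real.zero_rpow (by linarith)]) ?_
      have h3 : Filter.Tendsto (fun t : ℝ => t ^ (p - 1)) (nhdsWithin 0 (Set.Ici 0)) (nhds 0) := by
        have := (Real.continuous_rpow_const (q := p - 1) (by linarith)).tendsto 0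
        rw [Real.zero_rpow (by linarith)] at this
        exact this.mono_left nhdsWithin_le_nhds
      refine h3.congr' ?_
      filter_upwards [self_mem_nhdsWithin] with t ht
      rcases eq_or_lt_of_le (Set.mem_Ici.1 ht) with h0 | h0
      · rw [← h0, Real.zero_rpow (by linarith), div_zero]
      · rw [Real.rpow_sub_one h0.ne']
    refine h2.comp_tendsto (tendsto_nhdsWithin_iff.2 ⟨?_, Filter.Eventually.of_forall fun w =>
      norm_nonneg _⟩)
    have : Continuous fun w => ‖w - v‖ := by fun_prop
    simpa using this.tendsto v
  · exact (hT v hv).rpow_const (Or.inr hp.le)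

theorem differentiable_powInt [FiniteDimensional ℝ V] [FiniteDimensional ℝ W]
    (hh : IsNormLike h r R) (hp : 1 < p)
    (hF : MemLp F (ENNReal.ofReal p) μ)
    (hd : ∀ x v, F x v ≠ 0 → DifferentiableAt ℝ (fun v => h (F x v)) v) :
    Differentiable ℝ (powInt h p μ F) := by
  intro v
  borelize V
  borelize (V →L[ℝ] W)
  have hcont : Continuous fun q : (V →L[ℝ] W) × V => h (q.1 q.2) ^ p :=
    (hh.continuous.comp (continuous_fst.clm_apply continuous_snd)).rpow_const
      fun _ => Or.inr (by linarith)
  -- Only F is known to be measurable, so measurability of x ↦ the derivative at F x comes from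
  -- joint continuity in (T, v).
  have hm := measurable_fderiv_with_param ℝ
    (f := fun (T : V →L[ℝ] W) (v : V) => h (T v) ^ p) hcont
  refine (hasFDerivAt_integral_of_dominated_loc_of_lip (μ := μ) (x₀ := v)
    (F := fun v x => h (F x v) ^ p) (s := Metric.ball v 1)
    (bound := fun x => p * R ^ p * (‖v‖ + 1) ^ (p - 1) * ‖F x‖ ^ p)
    (F' := fun x => fderiv ℝ (fun v => h (F x v) ^ p) v)
    (Metric.ball_mem_nhds v one_pos) ?_ ?_ ?_ ?_ ?_ ?_).2.differentiableAt
  · exact Filter.Eventually.of_forall fun w => aestronglyMeasurable_rpow_apply hh hp hF w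
  · exact integrable_rpow_apply hh hp hF v
  · exact ((hm.comp (measurable_id.prodMk measurable_const)).comp_aemeasurable
      hF.1.aemeasurable).aestronglyMeasurable
  · refine Filter.Eventually.of_forall fun x => LipschitzOnWith.of_dist_le_mul fun a ha b hb => ?_
    have hball : ∀ w ∈ Metric.ball v 1, ‖w‖ ≤ ‖v‖ + 1 := fun w hw => by
      rw [Metric.mem_ball, dist_eq_norm] at hw
      have := norm_add_le (w - v) v
      rw [sub_add_cancel] at this
      linarith
    rw [Real.dist_eq, dist_eq_norm, Real.coe_nnabs]
    exact (abs_rpow_apply_sub_le hh hp (F x) (hball a ha) (hball b hb)).trans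
      (mul_le_mul_of_nonneg_right (le_abs_self _) (norm_nonneg _))
  · exact (integrable_norm_rpow hp hF).const_mul _
  · exact Filter.Eventually.of_forall fun x =>
      (differentiableAt_rpow_apply hh hp (hd x) v).hasFDerivAt

/-- Near v the Lipschitz constant is of order (‖v‖ + ε)^(p-1); let ε tend to 0. -/
theorem norm_fderiv_powInt_le (hh : IsNormLike h r R) (hp : 1 < p)
    (hF : MemLp F (ENNReal.ofReal p) μ) (hd : Differentiable ℝ (powInt h p μ F)) (v : V) :
    ‖fderiv ℝ (powInt h p μ F) v‖ ≤ p * R ^ p * (∫ x, ‖F x‖ ^ p ∂μ) * ‖v‖ ^ (p - 1) := by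
  have hR := hh.nonneg
  have hI : 0 ≤ ∫ x, ‖F x‖ ^ p ∂μ := integral_nonneg fun _ => Real.rpow_nonneg (norm_nonneg _) _
  have hε : ∀ ε : ℝ, 0 < ε → ‖fderiv ℝ (powInt h p μ F) v‖ ≤
      p * R ^ p * (∫ x, ‖F x‖ ^ p ∂μ) * (‖v‖ + ε) ^ (p - 1) := fun ε hε => by
    refine (hd v).hasFDerivAt.le_of_lip' (by positivity) ?_
    filter_upwards [Metric.ball_mem_nhds v hε] with w hw
    rw [Metric.mem_ball, dist_eq_norm] at hw
    refine abs_powInt_sub_le hh hp hF ?_ (by linarith)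
    have := norm_add_le (w - v) v
    rw [sub_add_cancel] at this
    linarith
  have hc : Continuous fun ε : ℝ =>
      p * R ^ p * (∫ x, ‖F x‖ ^ p ∂μ) * (‖v‖ + ε) ^ (p - 1) :=
    continuous_const.mul ((continuous_const.add continuous_id).rpow_const
      fun _ => Or.inr (by linarith))
  have hlim := (hc.tendsto 0).mono_left (nhdsWithin_le_nhds (s := Set.Ioi 0))
  rw [add_zero] at hlim
  exact ge_of_tendsto hlim (by filter_upwards [self_mem_nhdsWithin] with ε h using hε ε h)

end powerIntegral

/-! ### The polar projection body of a function -/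

section polarBody

variable {n m : ℕ} {p : ℝ} {Q : ConvexBody (E m)} {r R : ℝ}

/-- The field of linear maps `θ ↦ θᵗ ∇f(x)`. -/
def gradField (n m : ℕ) (f : E n → ℝ) (x : E n) : Mat n m →L[ℝ] E m :=
  (tmulCLM n m).flip (weakGrad f x)

theorem gaugePolarFun_eq (f : E n → ℝ) (θ : Mat n m) :
    gaugePolarFun Q p f θ =
      powInt (supportFn (Q : Set (E m))) p volume (gradField n m f) θ ^ (1 / p) := rfl

theorem MemW0.memLp_gradField {Ω : Opens (E n)} {f : E n → ℝ} (hf : MemW0 Ω p f) :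
    MemLp (gradField n m f) (ENNReal.ofReal p) volume :=
  ((tmulCLM n m).flip).comp_memLp' hf.memLp_weakGrad

/-- Since f agrees a.e. with 0 * f, uniqueness identifies its weak gradient with 0 • ∇f. -/
theorem MemW0.weakGrad_ae_eq_zero {Ω : Opens (E n)} {f : E n → ℝ} (hf : MemW0 Ω p f)
    (hf0 : f =ᵐ[volume] 0) : weakGrad f =ᵐ[volume] 0 := by
  have h1 : HasWeakGradient (fun x => (0 : ℝ) * f x) (fun x => (0 : ℝ) • weakGrad f x) :=
    hf.hasWeakGradient.const_mul 0
  have h2 : HasWeakGradient f (fun x => (0 : ℝ) • weakGrad f x) := by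
    refine h1.congr ?_
    filter_upwards [hf0] with x hx
    simp [hx]
  filter_upwards [h2.weakGrad_ae_eq] with x hx
  rw [hx, zero_smul, Pi.zero_apply]

theorem gaugePolarFun_nonneg
    (hh : IsNormLike (supportFn (Q : Set (E m))) r R) (f : E n → ℝ) (θ : Mat n m) :
    0 ≤ gaugePolarFun Q p f θ := by
  rw [gaugePolarFun_eq]
  exact Real.rpow_nonneg (powInt_nonneg hh θ) _

theorem gaugePolarFun_rpow
    (hh : IsNormLike (supportFn (Q : Set (E m))) r R) (hp : 1 < p) (f : E n → ℝ) (θ : Mat n m) :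
    gaugePolarFun Q p f θ ^ p =
      powInt (supportFn (Q : Set (E m))) p volume (gradField n m f) θ := by
  rw [gaugePolarFun_eq, ← Real.rpow_mul (powInt_nonneg hh θ), one_div_mul_cancel (by linarith),
    Real.rpow_one]

theorem gaugePolarFun_smul
    (hh : IsNormLike (supportFn (Q : Set (E m))) r R) (hp : 1 < p) (f : E n → ℝ) {c : ℝ} (hc :
    0 ≤ c) (θ : Mat n m) :
    gaugePolarFun Q p f (c • θ) = c * gaugePolarFun Q p f θ := by
  rw [gaugePolarFun_eq, powInt_smul hh hc, Real.mul_rpow (Real.rpow_nonneg hc _)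
    (powInt_nonneg hh θ), ← Real.rpow_mul hc, mul_one_div_cancel (by linarith), Real.rpow_one]
  rfl

theorem continuous_gaugePolarFun
    (hh : IsNormLike (supportFn (Q : Set (E m))) r R) (hp : 1 < p)
    {Ω : Opens (E n)} {f : E n → ℝ} (hf : MemW0 Ω p f) : Continuous (gaugePolarFun Q p f :
    Mat n m → ℝ) :=
  (continuous_powInt hh hp hf.memLp_gradField).rpow_const
    fun _ => Or.inr (by have : 0 < p := by linarith
                        positivity)

theorem isClosed_polarFun
    (hh : IsNormLike (supportFn (Q : Set (E m))) r R) (hp : 1 < p)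
    {Ω : Opens (E n)} {f : E n → ℝ} (hf : MemW0 Ω p f) : IsClosed (polarFun Q p f :
    Set (Mat n m)) :=
  isClosed_le (continuous_gaugePolarFun hh hp hf) continuous_const

/-- A zero of the gauge forces θᵗ∇f = 0 a.e.; a nonzero column of θ is then a direction in which f
has no derivative. -/
theorem gaugePolarFun_pos
    (hh : IsNormLike (supportFn (Q : Set (E m))) r R) (hp : 1 < p)
    {Ω : Opens (E n)} {f : E n → ℝ} (hf : MemW0 Ω p f) (hΩ : Bornology.IsBounded (Ω : Set (E n)))
    (hf0 : ¬ f =ᵐ[volume] 0) {θ : Mat n m} (hθ : θ ≠ 0) : 0 < gaugePolarFun Q p f θ := by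
  refine (gaugePolarFun_nonneg hh f θ).lt_of_ne' fun h0 => hf0 ?_
  have h1 := gaugePolarFun_rpow hh hp f θ
  rw [h0, Real.zero_rpow (by linarith), powInt, eq_comm, integral_eq_zero_iff_of_nonneg
    (fun _ => Real.rpow_nonneg (hh.apply_nonneg _) _)
    (integrable_rpow_apply hh hp hf.memLp_gradField θ)] at h1
  obtain ⟨⟨i, j⟩, hij⟩ : ∃ i, θ i ≠ 0 := by
    by_contra! hcon
    exact hθ (by ext i; simpa using hcon i)
  refine hf.ae_eq_zero_of_inner_weakGrad hp hΩ (w := WithLp.toLp 2 fun i => θ (i, j))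
    (fun hw => hij ?_) ?_
  · simpa using congrArg (fun v : E n => v i) hw
  · filter_upwards [h1] with x hx
    have h2 : tmul θ (weakGrad f x) = 0 := by
      refine hh.eq_zero ?_
      exact (Real.rpow_eq_zero (hh.apply_nonneg _) (by linarith)).1 hx
    have h3 := congrArg (fun v : E m => v j) h2
    simpa [tmul, PiLp.inner_apply, mul_comm] using h3

/-- The gauge has a positive minimum on the unit sphere, and homogeneity turns it into a bound on
the norm. -/
theorem isBounded_polarFun
    (hh : IsNormLike (supportFn (Q : Set (E m))) r R) (hp : 1 < p)
    {Ω : Opens (E n)} {f : E n → ℝ} (hf : MemW0 Ω p f) (hΩ : Bornology.IsBounded (Ω : Set (E n)))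
    (hf0 : ¬ f =ᵐ[volume] 0) : Bornology.IsBounded (polarFun Q p f : Set (Mat n m)) := by
  rcases subsingleton_or_nontrivial (Mat n m) with hs | hs
  · exact Set.subsingleton_of_subsingleton.finite.isBounded
  obtain ⟨θ₀, hθ₀, hmin⟩ := (isCompact_sphere (0 : Mat n m) 1).exists_isMinOn
    (NormedSpace.sphere_nonempty.2 zero_le_one) (continuous_gaugePolarFun hh hp hf).continuousOn
  have hpos := gaugePolarFun_pos hh hp hf hΩ hf0 (ne_zero_of_mem_unit_sphere ⟨θ₀, hθ₀⟩)
  refine isBounded_iff_forall_norm_le.2 ⟨(gaugePolarFun Q p f θ₀)⁻¹, fun θ hθ => ?_⟩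
  rcases eq_or_ne θ 0 with h0 | h0
  · rw [h0, norm_zero]
    exact inv_nonneg.2 hpos.le
  have hn : 0 < ‖θ‖ := norm_pos_iff.2 h0
  have h1 : gaugePolarFun Q p f θ₀ ≤ gaugePolarFun Q p f (‖θ‖⁻¹ • θ) :=
    hmin (by simp [norm_smul, hn.ne'])
  rw [gaugePolarFun_smul hh hp f (by positivity)] at h1
  have h2 : gaugePolarFun Q p f θ ≤ 1 := hθ
  have h3 : gaugePolarFun Q p f θ₀ ≤ ‖θ‖⁻¹ :=
    h1.trans (mul_le_of_le_one_right (by positivity) h2)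
  exact (le_inv_comm₀ hpos hn).1 h3

theorem volume_real_polarFun_pos
    (hh : IsNormLike (supportFn (Q : Set (E m))) r R) (hp : 1 < p)
    {Ω : Opens (E n)} {f : E n → ℝ} (hf : MemW0 Ω p f) (hΩ : Bornology.IsBounded (Ω : Set (E n)))
    (hf0 : ¬ f =ᵐ[volume] 0) : 0 < volume.real (polarFun Q p f : Set (Mat n m)) := by
  refine ENNReal.toReal_pos (Measure.measure_pos_of_mem_nhds volume (x := 0) ?_).ne'
    (isBounded_polarFun hh hp hf hΩ hf0).measure_lt_top.ne
  have h0 : gaugePolarFun Q p f (0 : Mat n m) = 0 := by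
    simpa using gaugePolarFun_smul hh hp f le_rfl (0 : Mat n m)
  filter_upwards [(continuous_gaugePolarFun hh hp hf).continuousAt.eventually_lt
    continuousAt_const (show gaugePolarFun Q p f (0 : Mat n m) < 1 by rw [h0]; exact one_pos)]
    with θ hθ using hθ.le

/-- The polar body is the whole space, of infinite measure because n, m > 0, and `ENNReal.toReal`
sends ∞ to 0. The later divisions by this volume therefore give 0. -/
theorem volume_real_polarFun_of_ae_eq_zero
    (hh : IsNormLike (supportFn (Q : Set (E m))) r R) (hp : 1 < p)
    {Ω : Opens (E n)} {f : E n → ℝ} (hf : MemW0 Ω p f) (hn : 0 < n) (hm : 0 < m) (hf0 :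
    f =ᵐ[volume] 0) :
    volume.real (polarFun Q p f : Set (Mat n m)) = 0 := by
  have hG := hf.weakGrad_ae_eq_zero hf0
  have huniv : (polarFun Q p f : Set (Mat n m)) = Set.univ := by
    refine Set.eq_univ_of_forall fun θ => ?_
    have : ∫ x, supportFn (Q : Set (E m)) (tmul θ (weakGrad f x)) ^ p = 0 := by
      refine integral_eq_zero_of_ae ?_
      filter_upwards [hG] with x hx
      have h0 : tmul θ (0 : E n) = 0 := (tmulCLM n m θ).map_zero
      rw [hx, Pi.zero_apply, h0, hh.map_zero, Real.zero_rpow (by linarith), Pi.zero_apply]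
    change gaugePolarFun Q p f θ ≤ 1
    rw [gaugePolarFun, this, Real.zero_rpow (by have : 0 < p := by linarith
                                                positivity)]
    exact zero_le_one
  have : Nonempty (Fin n × Fin m) := ⟨⟨0, hn⟩, ⟨0, hm⟩⟩
  rw [huniv, Measure.real, measure_univ_of_isAddLeftInvariant, ENNReal.toReal_top]

end polarBody

/-! ### The support function of `L_{Q,p,f}` -/

section bodyL

variable {n m : ℕ} {p : ℝ} {Q : ConvexBody (E m)} {r R : ℝ}

/-- The dilation factor in the definition of `L_{Q,p,f}`. -/
def coefL (Q : ConvexBody (E m)) (p : ℝ) (f : E n → ℝ) : ℝ :=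
  (m / ((n * m + p) * volume.real (Metric.closedBall (0 : E n) 1))) ^ (-(1 / p)) *
    (volume.real (polarBall n Q p) / volume.real (polarFun Q p f)) ^ (1 / (n * m : ℝ))

theorem coefL_nonneg (hp : 1 < p) (f : E n → ℝ) : 0 ≤ coefL Q p f := by
  have : 0 < p := by linarith
  unfold coefL
  positivity

/-- The integral `v ↦ ∫_L h_Q(xᵗv)^p dx`. -/
def momentFn (Q : ConvexBody (E m)) (p : ℝ) (L : Set (Mat n m)) (v : E n) : ℝ :=
  powInt (supportFn (Q : Set (E m))) p (volume.restrict L) (tmulCLM n m) v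

theorem momentFn_eq (L : Set (Mat n m)) (v : E n) :
    momentFn Q p L v = ∫ x in L, supportFn (Q : Set (E m)) (tmul x v) ^ p := rfl

theorem memLp_tmulCLM {L : Set (Mat n m)} (hL : Bornology.IsBounded L) (hLm : MeasurableSet L)
    (q : ENNReal) : MemLp (tmulCLM n m) q (volume.restrict L) := by
  have : IsFiniteMeasure (volume.restrict L) :=
    ⟨by rw [Measure.restrict_apply_univ]; exact hL.measure_lt_top⟩
  obtain ⟨C, hC⟩ := hL.exists_norm_le
  refine MemLp.of_bound (tmulCLM n m).continuous.aestronglyMeasurable (‖tmulCLM n m‖ * C) ?_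
  filter_upwards [ae_restrict_mem hLm] with x hx
  exact ((tmulCLM n m).le_opNorm x).trans
    (mul_le_mul_of_nonneg_left (hC x hx) (norm_nonneg (tmulCLM n m)))

theorem memLp_tmulCLM_polarFun
    (hh : IsNormLike (supportFn (Q : Set (E m))) r R) (hp : 1 < p)
    {Ω : Opens (E n)} {f : E n → ℝ} (hf : MemW0 Ω p f)
    (hΩ : Bornology.IsBounded (Ω : Set (E n))) (hf0 : ¬ f =ᵐ[volume] 0) (q : ENNReal) :
    MemLp (tmulCLM n m) q (volume.restrict (polarFun Q p f : Set (Mat n m))) :=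
  memLp_tmulCLM (isBounded_polarFun hh hp hf hΩ hf0)
    (isClosed_polarFun hh hp hf).measurableSet q

theorem isSublinear_centroid (hn : 0 < n) (hm : 0 < m)
    (hh : IsNormLike (supportFn (Q : Set (E m))) r R) (hp : 1 < p)
    {Ω : Opens (E n)} {f : E n → ℝ} (hf : MemW0 Ω p f)
    (hΩ : Bornology.IsBounded (Ω : Set (E n))) :
    IsSublinear fun v : E n => ((volume.real (polarFun Q p f : Set (Mat n m)))⁻¹ *
      momentFn Q p (polarFun Q p f) v) ^ (1 / p) := by
  by_cases hf0 : f =ᵐ[volume] 0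
  · have hp' : 1 / p ≠ 0 := by have : 0 < p := by linarith
                               positivity
    simp only [volume_real_polarFun_of_ae_eq_zero hh hp hf hn hm hf0, inv_zero, zero_mul,
      Real.zero_rpow hp']
    exact ⟨fun _ _ => by simp, fun _ _ _ => by simp⟩
  · have hs := isSublinear_powInt_rpow hh hp (memLp_tmulCLM_polarFun hh hp hf hΩ hf0 _)
    have hV : 0 ≤ (volume.real (polarFun Q p f : Set (Mat n m)))⁻¹ :=
      inv_nonneg.2 measureReal_nonneg
    have hmul : ∀ v : E n, ((volume.real (polarFun Q p f : Set (Mat n m)))⁻¹ *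
        momentFn Q p (polarFun Q p f) v) ^ (1 / p) =
        (volume.real (polarFun Q p f : Set (Mat n m)))⁻¹ ^ (1 / p) *
          momentFn Q p (polarFun Q p f) v ^ (1 / p) := fun v =>
      Real.mul_rpow hV (powInt_nonneg hh v)
    simp only [hmul]
    refine ⟨fun u v => ?_, fun c v hc => ?_⟩
    · rw [← mul_add]
      exact mul_le_mul_of_nonneg_left (hs.add_le u v) (Real.rpow_nonneg hV _)
    · rw [mul_left_comm]
      exact congrArg _ (hs.smul c v hc)

theorem supportFn_bodyL (hn : 0 < n) (hm : 0 < m)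
    (hh : IsNormLike (supportFn (Q : Set (E m))) r R) (hp : 1 < p)
    {Ω : Opens (E n)} {f : E n → ℝ} (hf : MemW0 Ω p f)
    (hΩ : Bornology.IsBounded (Ω : Set (E n))) (v : E n) :
    supportFn (bodyL Q p f) v = coefL Q p f *
      ((volume.real (polarFun Q p f : Set (Mat n m)))⁻¹ *
        momentFn Q p (polarFun Q p f) v) ^ (1 / p) := by
  have h1 : bodyL Q p f = coefL Q p f • centroidBody Q p (polarFun Q p f) := rfl
  rw [h1, supportFn_smul _ (coefL_nonneg hp f), centroidBody]
  congr 1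
  exact supportFn_bodyOfSupport (isSublinear_centroid hn hm hh hp hf hΩ) v

/-- The p-th power undoes the root in the centroid body, leaving a plain integral to differentiate.
-/
theorem potential_bodyL (hn : 0 < n) (hm : 0 < m)
    (hh : IsNormLike (supportFn (Q : Set (E m))) r R) (hp : 1 < p)
    {Ω : Opens (E n)} {f : E n → ℝ} (hf : MemW0 Ω p f)
    (hΩ : Bornology.IsBounded (Ω : Set (E n))) (v : E n) :
    1 / p * supportFn (bodyL Q p f) v ^ p =
      1 / p * (coefL Q p f ^ p * (volume.real (polarFun Q p f : Set (Mat n m)))⁻¹) *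
        momentFn Q p (polarFun Q p f) v := by
  have hV : 0 ≤ (volume.real (polarFun Q p f : Set (Mat n m)))⁻¹ *
      momentFn Q p (polarFun Q p f) v :=
    mul_nonneg (inv_nonneg.2 measureReal_nonneg) (powInt_nonneg hh v)
  rw [supportFn_bodyL hn hm hh hp hf hΩ, Real.mul_rpow (coefL_nonneg hp f)
    (Real.rpow_nonneg hV _), ← Real.rpow_mul hV, one_div_mul_cancel (by linarith), Real.rpow_one]
  ring

theorem IsSmoothBody.differentiableAt (hQ : IsSmoothBody n Q) (y : Mat n m) (v : E n)
    (hv : tmulCLM n m y v ≠ 0) :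
    DifferentiableAt ℝ (fun v => supportFn (Q : Set (E m)) (tmulCLM n m y v)) v := by
  have hopen : IsOpen {ξ : E n | tmul y ξ ≠ 0} :=
    isOpen_ne_fun (tmulCLM n m y).continuous continuous_const
  exact ((hQ.contDiffOn y).contDiffAt (hopen.mem_nhds hv)).differentiableAt (by simp)

/-- The potential `h_L^p / p` of `L = L_{Q,p,f}` is differentiable and its gradient has growth of
order `p - 1`. -/
theorem differentiable_potential_bodyL (hn : 0 < n) (hm : 0 < m)
    (hQ : IsSmoothBody n Q) (hp : 1 < p)
    {Ω : Opens (E n)} {f : E n → ℝ} (hf : MemW0 Ω p f)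
    (hΩ : Bornology.IsBounded (Ω : Set (E n))) :
    Differentiable ℝ (fun z => 1 / p * supportFn (bodyL Q p f) z ^ p) ∧
      ∃ C, ∀ z, ‖wulffField p (bodyL Q p f) z‖ ≤ C * ‖z‖ ^ (p - 1) := by
  obtain ⟨r, R, hh⟩ := exists_isNormLike_supportFn hQ.zero_mem_interior
  simp only [wulffField, potential_bodyL hn hm hh hp hf hΩ]
  by_cases hf0 : f =ᵐ[volume] 0
  · simp only [volume_real_polarFun_of_ae_eq_zero hh hp hf hn hm hf0, inv_zero, mul_zero, zero_mul]
    refine ⟨differentiable_const _, 0, fun z => ?_⟩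
    simp [gradient]
  · have hF := memLp_tmulCLM_polarFun hh hp hf hΩ hf0 (ENNReal.ofReal p)
    have hd : Differentiable ℝ (momentFn Q p (polarFun Q p f : Set (Mat n m))) :=
      differentiable_powInt hh hp hF hQ.differentiableAt
    obtain ⟨C, hC⟩ : ∃ C, ∀ z, ‖fderiv ℝ (momentFn Q p (polarFun Q p f : Set (Mat n m))) z‖ ≤
      C * ‖z‖ ^ (p - 1) := ⟨_, norm_fderiv_powInt_le hh hp hF hd⟩
    generalize 1 / p * (coefL Q p f ^ p * (volume.real (polarFun Q p f : Set (Mat n m)))⁻¹) = K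
    refine ⟨hd.const_mul K, ‖K‖ * C, fun z => ?_⟩
    rw [gradient_const_mul, norm_smul, gradient, LinearIsometryEquiv.norm_map, mul_assoc]
    exact mul_le_mul_of_nonneg_left (hC z) (norm_nonneg _)

theorem measurable_wulffField (p : ℝ) (K : Set (E n)) : Measurable (wulffField p K) :=
  (InnerProductSpace.toDual ℝ (E n)).symm.continuous.measurable.comp (measurable_fderiv ℝ _)

theorem memLp_of_norm_le_rpow (hp : 1 < p) {u : E n → E n}
    (hu : MemLp u (ENNReal.ofReal p) volume) {V : E n → E n} (hV : AEStronglyMeasurable V volume)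
    {C : ℝ} (hC : ∀ x, ‖V x‖ ≤ C * ‖u x‖ ^ (p - 1)) :
    MemLp V (ENNReal.ofReal (p / (p - 1))) volume := by
  have h1 : MemLp (fun x => ‖u x‖ ^ (p - 1)) (ENNReal.ofReal (p / (p - 1))) volume := by
    have := hu.norm_rpow_div (ENNReal.ofReal (p - 1))
    rwa [ENNReal.toReal_ofReal (by linarith), ← ENNReal.ofReal_div_of_pos (by linarith)] at this
  refine (h1.const_mul C).mono hV (Filter.Eventually.of_forall fun x => ?_)
  exact (hC x).trans (le_abs_self _)

theorem memLp_wulffField_bodyL (hn : 0 < n) (hm : 0 < m)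
    (hQ : IsSmoothBody n Q) (hp : 1 < p)
    {Ω : Opens (E n)} {f : E n → ℝ} (hf : MemW0 Ω p f)
    (hΩ : Bornology.IsBounded (Ω : Set (E n))) :
    MemLp (fun x => wulffField p (bodyL Q p f) (weakGrad f x))
      (ENNReal.ofReal (p / (p - 1))) volume := by
  obtain ⟨-, C, hC⟩ := differentiable_potential_bodyL hn hm hQ hp hf hΩ
  refine memLp_of_norm_le_rpow hp hf.memLp_weakGrad ?_ fun x => hC (weakGrad f x)
  exact ((measurable_wulffField p _).comp_aemeasurable
    hf.memLp_weakGrad.1.aemeasurable).aestronglyMeasurable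

theorem locallyIntegrable_of_memLp_conj (hp : 1 < p) {V : E n → E n}
    (hV : MemLp V (ENNReal.ofReal (p / (p - 1))) volume) : LocallyIntegrable V volume := by
  refine hV.locallyIntegrable ?_
  rw [← ENNReal.ofReal_one]
  refine ENNReal.ofReal_le_ofReal ?_
  rw [le_div_iff₀ (by linarith)]
  linarith

theorem affineLaplacian_apply (hn : 0 < n) (hm : 0 < m)
    (hQ : IsSmoothBody n Q) (hp : 1 < p)
    {Ω : Opens (E n)} {f : E n → ℝ} (hf : MemW0 Ω p f)
    (hΩ : Bornology.IsBounded (Ω : Set (E n))) (φ : 𝓓((⊤ : Opens (E n)), ℝ)) :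
    affineLaplacian Q p f φ = ∫ x, ⟪wulffField p (bodyL Q p f) (weakGrad f x),
      gradient (fun z => φ z) x⟫_ℝ :=
  negDiv_apply (locallyIntegrable_of_memLp_conj hp
    (memLp_wulffField_bodyL hn hm hQ hp hf hΩ)) φ

end bodyL

/-! ### Linear changes of variables -/

section leftMul

variable {n : ℕ} (m : ℕ)

/-- The column `j` of a matrix. -/
def col {m : ℕ} (θ : Mat n m) (j : Fin m) : E n := WithLp.toLp 2 fun i => θ (i, j)

/-- Left multiplication `θ ↦ Tθ` on matrices. -/
def leftMulLin (T : E n →ₗ[ℝ] E n) : Mat n m →ₗ[ℝ] Mat n m where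
  toFun θ := WithLp.toLp 2 fun q => T (col θ q.2) q.1
  map_add' θ η := by
    have : ∀ j, col (θ + η) j = col θ j + col η j := fun j => rfl
    ext q
    simp [this]
  map_smul' c θ := by
    have : ∀ j, col (c • θ) j = c • col θ j := fun j => rfl
    ext q
    simp [this]

variable {m}

theorem leftMulLin_apply (T : E n →ₗ[ℝ] E n) (θ : Mat n m) (q : Fin n × Fin m) :
    leftMulLin m T θ q = T (col θ q.2) q.1 := rfl

theorem col_leftMulLin (T : E n →ₗ[ℝ] E n) (θ : Mat n m) (j : Fin m) :
    col (leftMulLin m T θ) j = T (col θ j) := rfl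

theorem tmul_apply_eq_inner (θ : Mat n m) (ξ : E n) (j : Fin m) :
    tmul θ ξ j = ⟪col θ j, ξ⟫_ℝ := by
  simp [tmul, col, PiLp.inner_apply, mul_comm]

variable (m)

/-- Left multiplication `θ ↦ Tθ` by an invertible matrix. -/
def leftMul (T : E n ≃L[ℝ] E n) : Mat n m ≃L[ℝ] Mat n m :=
  (LinearEquiv.ofLinearMap (leftMulLin m (T : E n →ₗ[ℝ] E n)) (leftMulLin m (T.symm : E n →ₗ[ℝ] E n))
    (by
      ext1 θ
      ext q
      rw [LinearMap.comp_apply, leftMulLin_apply, col_leftMulLin]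
      simp [col])
    (by
      ext1 θ
      ext q
      rw [LinearMap.comp_apply, leftMulLin_apply, col_leftMulLin]
      simp [col])).toContinuousLinearEquiv

variable {m}

theorem leftMul_apply (T : E n ≃L[ℝ] E n) (θ : Mat n m) :
    leftMul m T θ = leftMulLin m (T : E n →ₗ[ℝ] E n) θ := rfl

/-- (Tθ)ᵗξ = θᵗ(Tᵗξ): the adjoint produced by the chain rule on gradients becomes left
multiplication on matrices. -/
theorem tmul_leftMul (T : E n ≃L[ℝ] E n) (θ : Mat n m) (ξ : E n) :
    tmul (leftMul m T θ) ξ = tmul θ (adjEquiv T ξ) := by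
  ext j
  rw [tmul_apply_eq_inner, tmul_apply_eq_inner, inner_adjEquiv_right]
  rfl

theorem norm_sq_eq_sum_col (θ : Mat n m) : ‖θ‖ ^ 2 = ∑ j, ‖col θ j‖ ^ 2 := by
  simp_rw [EuclideanSpace.real_norm_sq_eq, Fintype.sum_prod_type_right]
  rfl

theorem norm_leftMul (U : E n ≃ₗᵢ[ℝ] E n) (θ : Mat n m) :
    ‖leftMul m U.toContinuousLinearEquiv θ‖ = ‖θ‖ := by
  refine (sq_eq_sq₀ (norm_nonneg _) (norm_nonneg _)).1 ?_
  rw [norm_sq_eq_sum_col, norm_sq_eq_sum_col]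
  refine Finset.sum_congr rfl fun j _ => ?_
  rw [leftMul_apply, col_leftMulLin]
  exact congrArg (· ^ 2) (U.norm_map (col θ j))

theorem measurePreserving_leftMul_isometry (U : E n ≃ₗᵢ[ℝ] E n) :
    MeasurePreserving (leftMul m U.toContinuousLinearEquiv) volume volume :=
  (LinearIsometryEquiv.mk (leftMul m U.toContinuousLinearEquiv).toLinearEquiv
    (norm_leftMul U)).measurePreserving

theorem measurePreserving_of_det_eq_one {V : Type*} [NormedAddCommGroup V] [InnerProductSpace ℝ V]
    [FiniteDimensional ℝ V] [MeasurableSpace V] [BorelSpace V] (T : V →ₗ[ℝ] V)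
    (hT : LinearMap.det T = 1) : MeasurePreserving T volume volume := by
  refine ⟨(LinearMap.continuous_of_finiteDimensional T).measurable, ?_⟩
  rw [Measure.map_linearMap_addHaar_eq_smul_addHaar volume (by rw [hT]; exact one_ne_zero), hT]
  simp

theorem det_toEuclideanLin {ι : Type*} [Fintype ι] [DecidableEq ι] (M : Matrix ι ι ℝ) :
    LinearMap.det (Matrix.toEuclideanLin M) = M.det := by
  rw [Matrix.toEuclideanLin_eq_toLin_orthonormal, LinearMap.det_toLin]

/-- `x ↦ Ax` as a linear equivalence. -/
def slEquiv (A : Matrix.SpecialLinearGroup (Fin n) ℝ) : E n ≃L[ℝ] E n :=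
  ContinuousLinearEquiv.equivOfInverse (slMap A) (slMap A⁻¹) (slMap_inv_apply A)
    (slMap_apply_inv A)

theorem measurePreserving_slEquiv (A : Matrix.SpecialLinearGroup (Fin n) ℝ) :
    MeasurePreserving (slEquiv A) volume volume :=
  measurePreserving_of_det_eq_one (Matrix.toEuclideanLin (A : Matrix (Fin n) (Fin n) ℝ))
    (by rw [det_toEuclideanLin, A.det_coe])

/-- Left multiplication by A is the Kronecker product of A with the identity, whose determinant is a
power of det A = 1. -/
theorem measurePreserving_leftMul_slEquiv (A : Matrix.SpecialLinearGroup (Fin n) ℝ) :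
    MeasurePreserving (leftMul m (slEquiv A)) volume volume := by
  have h : (leftMul m (slEquiv A) : Mat n m → Mat n m) = Matrix.toEuclideanLin
      (Matrix.kronecker (A : Matrix (Fin n) (Fin n) ℝ) (1 : Matrix (Fin m) (Fin m) ℝ)) := by
    ext θ q
    obtain ⟨i, j⟩ := q
    have h1 : leftMul m (slEquiv A) θ (i, j) = ∑ k, (A : Matrix (Fin n) (Fin n) ℝ) i k * θ (k, j) :=
      rfl
    rw [h1, Matrix.ofLp_toLpLin, Matrix.toLin'_apply, Matrix.mulVec, dotProduct,
      Fintype.sum_prod_type]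
    simp [Matrix.one_apply]
  rw [h]
  refine measurePreserving_of_det_eq_one _ ?_
  rw [det_toEuclideanLin, Matrix.kronecker, Matrix.det_kronecker, A.det_coe]
  simp

end leftMul

/-! ### Behaviour of Π°f, L_{Q,p,f} and the operator under f ↦ f ∘ T -/

section changeOfVariables

variable {n m : ℕ} {p : ℝ} {Q : ConvexBody (E m)}

theorem gaugePolarFun_congr {f : E n → ℝ} {G : E n → E n} (h : weakGrad f =ᵐ[volume] G)
    (θ : Mat n m) : gaugePolarFun Q p f θ =
      (∫ x, supportFn (Q : Set (E m)) (tmul θ (G x)) ^ p) ^ (1 / p) := by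
  rw [gaugePolarFun]
  congr 1
  refine integral_congr_ae ?_
  filter_upwards [h] with x hx
  rw [hx]

theorem HasWeakGradient.gaugePolarFun_comp {f : E n → ℝ} (hf : HasWeakGradient f (weakGrad f))
    (T : E n ≃L[ℝ] E n) (hT : MeasurePreserving T volume volume) (θ : Mat n m) :
    gaugePolarFun Q p (fun x => f (T x)) θ = gaugePolarFun Q p f (leftMul m T θ) := by
  rw [gaugePolarFun_congr (hf.comp_equiv T hT).weakGrad_ae_eq, gaugePolarFun]
  simp_rw [← tmul_leftMul]
  rw [hT.integral_comp T.toHomeomorph.measurableEmbedding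
    (fun x => supportFn (Q : Set (E m)) (tmul (leftMul m T θ) (weakGrad f x)) ^ p)]

theorem HasWeakGradient.polarFun_comp {f : E n → ℝ} (hf : HasWeakGradient f (weakGrad f))
    (T : E n ≃L[ℝ] E n) (hT : MeasurePreserving T volume volume) :
    (polarFun Q p (fun x => f (T x)) : Set (Mat n m)) = leftMul m T ⁻¹' polarFun Q p f := by
  ext θ
  simp only [polarFun, Set.mem_ofPred_eq, Set.mem_preimage, hf.gaugePolarFun_comp T hT]

theorem volume_real_preimage_leftMul (T : E n ≃L[ℝ] E n)
    (hT : MeasurePreserving (leftMul m T) volume volume) (L : Set (Mat n m)) :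
    volume.real (leftMul m T ⁻¹' L) = volume.real L := by
  rw [Measure.real, hT.measure_preimage_emb (leftMul m T).toHomeomorph.measurableEmbedding,
    Measure.real]

theorem momentFn_preimage_leftMul (T : E n ≃L[ℝ] E n)
    (hT : MeasurePreserving (leftMul m T) volume volume) (L : Set (Mat n m)) (ξ : E n) :
    momentFn Q p (leftMul m T ⁻¹' L) (adjEquiv T ξ) = momentFn Q p L ξ := by
  rw [momentFn_eq, momentFn_eq]
  simp_rw [← tmul_leftMul]
  exact hT.setIntegral_preimage_emb (leftMul m T).toHomeomorph.measurableEmbedding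
    (fun x => supportFn (Q : Set (E m)) (tmul x ξ) ^ p) L

theorem adjEquiv_adjEquiv (T : E n ≃L[ℝ] E n) (x : E n) : adjEquiv (adjEquiv T) x = T x :=
  ext_inner_right ℝ fun y => by rw [inner_adjEquiv_left, inner_adjEquiv_right]

/-- In terms of bodies, L_{f∘T} = T⁻¹ L_f: both volumes are unchanged and the moments correspond
under θ ↦ Tθ. -/
theorem MemW0.supportFn_bodyL_comp (hn : 0 < n) (hm : 0 < m)
    (hQ : IsSmoothBody n Q) (hp : 1 < p) {Ω Ω' : Opens (E n)} {f : E n → ℝ} (hf : MemW0 Ω p f)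
    (hΩ : Bornology.IsBounded (Ω : Set (E n))) (hΩ' : Bornology.IsBounded (Ω' : Set (E n)))
    (T : E n ≃L[ℝ] E n) (hTΩ : ∀ x, T x ∈ Ω → x ∈ Ω') (hT : MeasurePreserving T volume volume)
    (hT' : MeasurePreserving (leftMul m T) volume volume) (ξ : E n) :
    supportFn (bodyL Q p (fun x => f (T x))) (adjEquiv T ξ) = supportFn (bodyL Q p f) ξ := by
  obtain ⟨r, R, hh⟩ := exists_isNormLike_supportFn hQ.zero_mem_interior
  rw [supportFn_bodyL hn hm hh hp (hf.comp_equiv T hT hTΩ) hΩ',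
    supportFn_bodyL hn hm hh hp hf hΩ, coefL, coefL, hf.hasWeakGradient.polarFun_comp T hT,
    volume_real_preimage_leftMul T hT', momentFn_preimage_leftMul T hT']

theorem MemW0.affineLaplacian_comp (hn : 0 < n) (hm : 0 < m)
    (hQ : IsSmoothBody n Q) (hp : 1 < p) {Ω Ω' : Opens (E n)} {f : E n → ℝ} (hf : MemW0 Ω p f)
    (hΩ : Bornology.IsBounded (Ω : Set (E n))) (hΩ' : Bornology.IsBounded (Ω' : Set (E n)))
    (T : E n ≃L[ℝ] E n) (hTΩ : ∀ x, T x ∈ Ω → x ∈ Ω') (hT : MeasurePreserving T volume volume)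
    (hT' : MeasurePreserving (leftMul m T) volume volume) (φ : 𝓓((⊤ : Opens (E n)), ℝ)) :
    affineLaplacian Q p (fun x => f (T x)) φ =
      affineLaplacian Q p f (testCompEquiv T.symm (fun _ _ => trivial) φ) := by
  have hf' := hf.comp_equiv T hT hTΩ
  rw [affineLaplacian_apply hn hm hQ hp hf' hΩ', affineLaplacian_apply hn hm hQ hp hf hΩ]
  set ψ : 𝓓((⊤ : Opens (E n)), ℝ) := testCompEquiv T.symm (fun _ _ => trivial) φ
  have hφ : (fun z => φ z) = fun z => ψ (T z) := by
    ext z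
    change φ z = φ (T.symm (T z))
    rw [T.symm_apply_apply]
  -- Differentiate the relation between the two potentials; the adjoint of Tᵗ is T.
  have hfield : ∀ ξ, wulffField p (bodyL Q p f) ξ =
      T (wulffField p (bodyL Q p (fun x => f (T x))) (adjEquiv T ξ)) := fun ξ => by
    have h1 : (fun w => 1 / p * supportFn (bodyL Q p f) w ^ p) =
        fun w => (fun w => 1 / p * supportFn (bodyL Q p (fun x => f (T x))) w ^ p)
          (adjEquiv T w) := by
      ext w
      rw [← hf.supportFn_bodyL_comp hn hm hQ hp hΩ hΩ' T hTΩ hT hT' w]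
    rw [wulffField, h1, gradient_comp_equiv (adjEquiv T)
      (fun w => 1 / p * supportFn (bodyL Q p (fun x => f (T x))) w ^ p), adjEquiv_adjEquiv]
    rfl
  rw [← hT.integral_comp T.toHomeomorph.measurableEmbedding
    (fun x => ⟪wulffField p (bodyL Q p f) (weakGrad f x), gradient (fun z => ψ z) x⟫_ℝ)]
  refine integral_congr_ae ?_
  filter_upwards [(hf.hasWeakGradient.comp_equiv T hT).weakGrad_ae_eq] with x hx
  rw [hx, hφ, gradient_comp_equiv T (fun z => ψ z), inner_adjEquiv_right, hfield]

end changeOfVariables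

/-! ### Dilations -/

section dilation

variable {n m : ℕ} {p : ℝ} {Q : ConvexBody (E m)}

theorem HasWeakGradient.gaugePolarFun_const_mul {f : E n → ℝ}
    (hf : HasWeakGradient f (weakGrad f)) (a : ℝ) (θ : Mat n m) :
    gaugePolarFun Q p (fun x => a * f x) θ = gaugePolarFun Q p f (a • θ) := by
  rw [gaugePolarFun_congr (hf.const_mul a).weakGrad_ae_eq, gaugePolarFun]
  have : ∀ x, tmul θ (a • weakGrad f x) = tmul (a • θ) (weakGrad f x) := fun x => by
    simp_rw [← tmulCLM_apply, map_smul]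
    rfl
  simp_rw [this]

theorem HasWeakGradient.polarFun_const_mul {f : E n → ℝ}
    (hf : HasWeakGradient f (weakGrad f)) (a : ℝ) :
    (polarFun Q p (fun x => a * f x) : Set (Mat n m)) = (fun θ => a • θ) ⁻¹' polarFun Q p f := by
  ext θ
  simp only [polarFun, Set.mem_ofPred_eq, Set.mem_preimage, hf.gaugePolarFun_const_mul a]

theorem finrank_mat : Module.finrank ℝ (Mat n m) = n * m := by
  simp

theorem volume_real_preimage_smul {a : ℝ} (ha : 0 < a) (L : Set (Mat n m)) :
    volume.real ((fun θ => a • θ) ⁻¹' L) = (a ^ (n * m))⁻¹ * volume.real L := by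
  rw [Measure.real, Measure.addHaar_preimage_smul volume ha.ne', ENNReal.toReal_mul,
    ENNReal.toReal_ofReal (abs_nonneg _), finrank_mat, abs_of_nonneg (by positivity),
    Measure.real]

theorem momentFn_smul {r R : ℝ} (hh : IsNormLike (supportFn (Q : Set (E m))) r R)
    {c : ℝ} (hc : 0 ≤ c) (L : Set (Mat n m)) (v : E n) :
    momentFn Q p L (c • v) = c ^ p * momentFn Q p L v := powInt_smul hh hc v

theorem momentFn_preimage_smul {r R : ℝ} (hh : IsNormLike (supportFn (Q : Set (E m))) r R)
    {a : ℝ} (ha : 0 < a) (L : Set (Mat n m)) (v : E n) :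
    momentFn Q p ((fun θ => a • θ) ⁻¹' L) v = (a ^ (n * m))⁻¹ * (a⁻¹ ^ p * momentFn Q p L v) := by
  have h1 := Measure.setIntegral_comp_smul (volume : Measure (Mat n m))
    (fun x => supportFn (Q : Set (E m)) (tmul x (a⁻¹ • v)) ^ p) ((fun θ => a • θ) ⁻¹' L) ha.ne'
  have h2 : ∀ x : Mat n m, tmul (a • x) (a⁻¹ • v) = tmul x v := fun x => by
    simp_rw [← tmulCLM_apply, map_smul, smul_apply, smul_smul,
      inv_mul_cancel₀ ha.ne', one_smul]
  have h3 : a • (fun θ : Mat n m => a • θ) ⁻¹' L = L := by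
    rw [Set.preimage_smul₀ ha.ne', smul_inv_smul₀ ha.ne']
  simp_rw [h2] at h1
  rw [h3, finrank_mat, abs_of_nonneg (by positivity), smul_eq_mul] at h1
  rw [momentFn_eq, h1, ← momentFn_eq, momentFn_smul hh (inv_nonneg.2 ha.le)]

theorem coefL_const_mul (hn : 0 < n) (hm : 0 < m) {f : E n → ℝ}
    (hf : HasWeakGradient f (weakGrad f)) {a : ℝ} (ha : 0 < a) :
    coefL Q p (fun x => a * f x) = a * coefL Q p f := by
  have hnm : (n * m : ℝ) ≠ 0 := by positivity
  have h1 : ∀ x y : ℝ, x / ((a ^ (n * m))⁻¹ * y) = a ^ (n * m) * (x / y) := fun x y => by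
    rw [div_mul_eq_div_div, div_inv_eq_mul, mul_comm x, mul_div_assoc]
  rw [coefL, hf.polarFun_const_mul, volume_real_preimage_smul ha, h1,
    Real.mul_rpow (by positivity) (by positivity), ← Real.rpow_natCast, ← Real.rpow_mul ha.le,
    Nat.cast_mul, mul_one_div_cancel hnm, Real.rpow_one, coefL]
  ring

/-- The polar body shrinks by a, so the volume ratio contributes a factor a, which cancels the a⁻¹
from the centroid body. -/
theorem MemW0.supportFn_bodyL_const_mul (hn : 0 < n) (hm : 0 < m)
    (hQ : IsSmoothBody n Q) (hp : 1 < p) {Ω : Opens (E n)} {f : E n → ℝ} (hf : MemW0 Ω p f)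
    (hΩ : Bornology.IsBounded (Ω : Set (E n))) {a : ℝ} (ha : 0 < a) (v : E n) :
    supportFn (bodyL Q p (fun x => a * f x)) v = supportFn (bodyL Q p f) v := by
  obtain ⟨r, R, hh⟩ := exists_isNormLike_supportFn hQ.zero_mem_interior
  have hM : 0 ≤ momentFn Q p (polarFun Q p f : Set (Mat n m)) v := powInt_nonneg hh v
  rw [supportFn_bodyL hn hm hh hp (hf.const_mul a) hΩ, supportFn_bodyL hn hm hh hp hf hΩ,
    coefL_const_mul hn hm hf.hasWeakGradient ha, hf.hasWeakGradient.polarFun_const_mul,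
    volume_real_preimage_smul ha, momentFn_preimage_smul hh ha]
  have h1 : ((a ^ (n * m))⁻¹ * volume.real (polarFun Q p f : Set (Mat n m)))⁻¹ *
      ((a ^ (n * m))⁻¹ * (a⁻¹ ^ p * momentFn Q p (polarFun Q p f) v)) =
      a⁻¹ ^ p * ((volume.real (polarFun Q p f : Set (Mat n m)))⁻¹ *
        momentFn Q p (polarFun Q p f) v) := by
    have : (a ^ (n * m)) ≠ 0 := by positivity
    rw [mul_inv, inv_inv]
    field_simp
  rw [h1, Real.mul_rpow (by positivity) (by positivity), ← Real.rpow_mul (by positivity),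
    mul_one_div_cancel (by linarith), Real.rpow_one]
  field_simp

/-- The potential is p-homogeneous, so its gradient is (p-1)-homogeneous: differentiate and divide
by a. -/
theorem wulffField_smul {r R : ℝ} (hh : IsNormLike (supportFn (Q : Set (E m))) r R)
    (hn : 0 < n) (hm : 0 < m) (hp : 1 < p) {Ω : Opens (E n)} {f : E n → ℝ} (hf : MemW0 Ω p f)
    (hΩ : Bornology.IsBounded (Ω : Set (E n))) {a : ℝ} (ha : 0 < a) (v : E n) :
    wulffField p (bodyL Q p f) (a • v) = a ^ (p - 1) • wulffField p (bodyL Q p f) v := by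
  simp only [wulffField, potential_bodyL hn hm hh hp hf hΩ, gradient_const_mul]
  rw [smul_comm]
  congr 1
  have h1 := fderiv_comp_smul (𝕜 := ℝ) (f := momentFn Q p (polarFun Q p f : Set (Mat n m)))
    (x := v) a
  have h2 : (fun x => momentFn Q p (polarFun Q p f : Set (Mat n m)) (a • x)) =
      fun x => a ^ p * momentFn Q p (polarFun Q p f) x := funext fun x => powInt_smul hh ha.le x
  rw [h2] at h1
  have h3 := gradient_const_mul (a ^ p) (momentFn Q p (polarFun Q p f : Set (Mat n m))) v
  rw [gradient, h1, map_smul] at h3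
  have h4 : a ^ p = a * a ^ (p - 1) := by
    rw [mul_comm, ← Real.rpow_add_one ha.ne', sub_add_cancel]
  rw [h4, mul_smul] at h3
  exact smul_right_injective _ ha.ne' h3

theorem MemW0.affineLaplacian_const_mul (hn : 0 < n) (hm : 0 < m)
    (hQ : IsSmoothBody n Q) (hp : 1 < p) {Ω : Opens (E n)} {f : E n → ℝ} (hf : MemW0 Ω p f)
    (hΩ : Bornology.IsBounded (Ω : Set (E n))) {a : ℝ} (ha : 0 < a) :
    affineLaplacian Q p (fun x => a * f x) = a ^ (p - 1) • affineLaplacian Q p f := by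
  obtain ⟨r, R, hh⟩ := exists_isNormLike_supportFn hQ.zero_mem_interior
  ext φ
  change _ = a ^ (p - 1) • affineLaplacian Q p f φ
  rw [affineLaplacian_apply hn hm hQ hp (hf.const_mul a) hΩ,
    affineLaplacian_apply hn hm hQ hp hf hΩ, smul_eq_mul, ← integral_const_mul]
  refine integral_congr_ae ?_
  filter_upwards [(hf.hasWeakGradient.const_mul a).weakGrad_ae_eq] with x hx
  have h1 : ∀ ξ, wulffField p (bodyL Q p (fun x => a * f x)) ξ = wulffField p (bodyL Q p f) ξ :=
    fun ξ => by
      simp only [wulffField, hf.supportFn_bodyL_const_mul hn hm hQ hp hΩ ha]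
  rw [hx, h1, wulffField_smul hh hn hm hp hf hΩ ha, inner_smul_left]
  simp

end dilation

/-! ### Rotation invariant measures on the sphere -/

section invariantMeasure

variable {V : Type*} [NormedAddCommGroup V] [InnerProductSpace ℝ V]

/-- The reflection in the hyperplane orthogonal to u - w. -/
theorem exists_isometry_apply_eq {u w : V} (h : ‖u‖ = ‖w‖) : ∃ U : V ≃ₗᵢ[ℝ] V, U u = w :=
  ⟨(ℝ ∙ (u - w))ᗮ.reflection, Submodule.reflection_sub h⟩

variable [MeasurableSpace V] [BorelSpace V]

theorem measure_ball_eq_of_invariant {ν : Measure V}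
    (hνU : ∀ U : V ≃ₗᵢ[ℝ] V, MeasurePreserving U ν ν) {u w : V} (h : ‖u‖ = ‖w‖) (ε : ℝ) :
    ν (Metric.ball u ε) = ν (Metric.ball w ε) := by
  obtain ⟨U, hU⟩ := exists_isometry_apply_eq h
  rw [← (hνU U).measure_preimage (s := Metric.ball w ε)
    Metric.isOpen_ball.measurableSet.nullMeasurableSet, ← hU, U.isometry.preimage_ball]

variable [FiniteDimensional ℝ V]

/-- If one ball were null, rotations would make all balls of that radius centred on the sphere null,
and compactness would make the sphere null. -/
theorem measure_ball_pos_of_invariant {ν : Measure V} (hν : ∀ᵐ x ∂ν, ‖x‖ = 1) (hν0 : ν ≠ 0)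
    (hνU : ∀ U : V ≃ₗᵢ[ℝ] V, MeasurePreserving U ν ν) {e : V} (he : ‖e‖ = 1) {ε : ℝ}
    (hε : 0 < ε) : 0 < ν (Metric.ball e ε) := by
  refine pos_iff_ne_zero.2 fun h0 => hν0 ?_
  have h1 : ν (Metric.sphere (0 : V) 1) = 0 := by
    refine (isCompact_sphere (0 : V) 1).measure_zero_of_nhdsWithin fun u hu =>
      ⟨Metric.ball u ε, mem_nhdsWithin_of_mem_nhds (Metric.ball_mem_nhds u hε), ?_⟩
    rw [measure_ball_eq_of_invariant hνU (w := e) (by rw [he]; simpa using hu), h0]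
  rw [← Measure.measure_univ_eq_zero, ← Set.union_compl_self (Metric.sphere (0 : V) 1)]
  refine measure_union_null h1 ?_
  have : (Metric.sphere (0 : V) 1)ᶜ = {x | ¬ ‖x‖ = 1} := by
    ext x
    simp
  rw [this]
  exact hν

theorem integrable_of_continuous_of_ae_norm_eq {ν : Measure V} [IsFiniteMeasure ν]
    (hν : ∀ᵐ x ∂ν, ‖x‖ = 1) {g : V → ℝ} (hg : Continuous g) : Integrable g ν := by
  obtain ⟨C, hC⟩ := (isCompact_sphere (0 : V) 1).exists_bound_of_continuousOn hg.continuousOn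
  refine Integrable.of_bound hg.aestronglyMeasurable C ?_
  filter_upwards [hν] with x hx using hC x (by simpa using hx)

/-- Fubini on {dist < ε}: the inner ν-measure of a ball does not depend on its centre on the sphere.
-/
theorem integral_setIntegral_ball {ν σ : Measure V} [IsFiniteMeasure ν] [IsFiniteMeasure σ]
    (hσ : ∀ᵐ x ∂σ, ‖x‖ = 1) (hνU : ∀ U : V ≃ₗᵢ[ℝ] V, MeasurePreserving U ν ν) {e : V}
    (he : ‖e‖ = 1) {g : V → ℝ} (hg : Continuous g) (ε : ℝ) :
    ∫ u, ∫ v in Metric.ball u ε, g v ∂σ ∂ν = ν.real (Metric.ball e ε) * ∫ v, g v ∂σ := by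
  have hS : MeasurableSet {q : V × V | dist q.2 q.1 < ε} :=
    (isOpen_lt (continuous_snd.dist continuous_fst) continuous_const).measurableSet
  have hint : Integrable ({q : V × V | dist q.2 q.1 < ε}.indicator fun q => g q.2)
      (ν.prod σ) :=
    ((integrable_of_continuous_of_ae_norm_eq hσ hg).comp_snd ν).indicator hS
  have h1 : ∀ u, ∫ v in Metric.ball u ε, g v ∂σ =
      ∫ v, ({q : V × V | dist q.2 q.1 < ε}.indicator fun q => g q.2) (u, v) ∂σ := fun u => by
    rw [← integral_indicator Metric.isOpen_ball.measurableSet]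
    rfl
  simp_rw [h1]
  rw [integral_integral_swap (f := fun u v =>
    ({q : V × V | dist q.2 q.1 < ε}.indicator fun q => g q.2) (u, v)) hint, ← integral_const_mul]
  refine integral_congr_ae ?_
  filter_upwards [hσ] with v hv
  have h2 : (fun u => ({q : V × V | dist q.2 q.1 < ε}.indicator fun q => g q.2) (u, v)) =
      (Metric.ball v ε).indicator fun _ => g v := by
    ext u
    simp only [Set.indicator, Metric.mem_ball, dist_comm u v]
    rfl
  rw [h2, integral_indicator Metric.isOpen_ball.measurableSet, setIntegral_const, smul_eq_mul,
    Measure.real, Measure.real, measure_ball_eq_of_invariant hνU (hv.trans he.symm)]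

/-- Two rotation invariant measures on the sphere are proportional. -/
theorem integral_eq_of_invariant {ν σ : Measure V} [IsFiniteMeasure ν] [IsFiniteMeasure σ]
    (hν : ∀ᵐ x ∂ν, ‖x‖ = 1) (hσ : ∀ᵐ x ∂σ, ‖x‖ = 1)
    (hνU : ∀ U : V ≃ₗᵢ[ℝ] V, MeasurePreserving U ν ν)
    (hσU : ∀ U : V ≃ₗᵢ[ℝ] V, MeasurePreserving U σ σ) {g : V → ℝ} (hg : Continuous g) :
    σ.real Set.univ * ∫ v, g v ∂ν = ν.real Set.univ * ∫ v, g v ∂σ := by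
  rcases eq_or_ne σ 0 with rfl | hσ0
  · simp
  have : Filter.NeBot (ae σ) := ae_neBot.2 hσ0
  obtain ⟨e, he⟩ := hσ.exists
  have hνg := integrable_of_continuous_of_ae_norm_eq hν hg
  have hσg := integrable_of_continuous_of_ae_norm_eq hσ hg
  set a := σ.real Set.univ
  set b := ν.real Set.univ
  have ha : 0 ≤ a := measureReal_nonneg
  have hb : 0 ≤ b := measureReal_nonneg
  -- Replace g(u) by its σ-average over the ε-ball at u, at cost η by uniform continuity, and
  -- average over ν by the preceding lemma.
  have key : ∀ η : ℝ, 0 < η → |a * ∫ v, g v ∂ν - b * ∫ v, g v ∂σ| ≤ η * (a * b) := fun η hη => by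
    obtain ⟨ε, hε, hgε⟩ := Metric.uniformContinuousOn_iff.1
      ((isCompact_sphere (0 : V) 1).uniformContinuousOn_of_continuous hg.continuousOn) η hη
    set k := σ.real (Metric.ball e ε)
    set l := ν.real (Metric.ball e ε)
    have hk : 0 < k := ENNReal.toReal_pos (measure_ball_pos_of_invariant hσ hσ0 hσU he hε).ne'
      (measure_ne_top _ _)
    have hball : ∀ u, ‖u‖ = 1 → σ.real (Metric.ball u ε) = k := fun u hu => by
      rw [Measure.real, measure_ball_eq_of_invariant hσU (hu.trans he.symm)]
      rfl
    -- The same Fubini identity with g = 1 relates the ball measures to the total masses.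
    have hone : k * b = l * a := by
      have h1 := integral_setIntegral_ball hσ hνU he (continuous_const (y := (1 : ℝ))) ε
      simp only [integral_const, smul_eq_mul, mul_one] at h1
      rw [← h1, integral_congr_ae (g := fun _ => k), integral_const, smul_eq_mul, mul_comm]
      filter_upwards [hν] with u hu using (measureReal_restrict_apply_univ _).trans (hball u hu)
    have h2 := integral_setIntegral_ball hσ hνU he hg ε
    have hFi : Integrable (fun u => ∫ v in Metric.ball u ε, g v ∂σ) ν := by
      have hS : MeasurableSet {q : V × V | dist q.2 q.1 < ε} :=
        (isOpen_lt (continuous_snd.dist continuous_fst) continuous_const).measurableSet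
      refine ((hσg.comp_snd ν).indicator hS).integral_prod_left.congr
        (Filter.Eventually.of_forall fun u => ?_)
      change _ = ∫ v in Metric.ball u ε, g v ∂σ
      rw [← integral_indicator Metric.isOpen_ball.measurableSet]
      rfl
    have h3 : |k * ∫ u, g u ∂ν - l * ∫ v, g v ∂σ| ≤ η * k * b := by
      rw [← h2, ← integral_const_mul, ← integral_sub (hνg.const_mul k) hFi, ← Real.norm_eq_abs]
      refine norm_integral_le_of_norm_le_const ?_
      filter_upwards [hν] with u hu
      have h4 : k * g u = ∫ v in Metric.ball u ε, g u ∂σ := by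
        rw [setIntegral_const, hball u hu, smul_eq_mul]
      rw [h4, ← integral_sub (integrable_const _).integrableOn hσg.integrableOn]
      refine (norm_setIntegral_le_of_norm_le_const_ae' (C := η) (measure_lt_top _ _) ?_).trans
        (le_of_eq (by rw [hball u hu]))
      filter_upwards [hσ] with v hv hvu
      rw [← dist_eq_norm]
      exact (hgε u (by simpa using hu) v (by simpa using hv) (by rwa [dist_comm])).le
    have h5 : k * |a * ∫ v, g v ∂ν - b * ∫ v, g v ∂σ| ≤ k * (η * (a * b)) := by
      rw [← abs_of_pos hk, ← abs_mul, abs_of_pos hk]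
      have h6 : k * (a * ∫ v, g v ∂ν - b * ∫ v, g v ∂σ) =
          a * (k * ∫ u, g u ∂ν - l * ∫ v, g v ∂σ) := by
        linear_combination (-∫ v, g v ∂σ) * hone
      rw [h6, abs_mul, abs_of_nonneg ha]
      refine (mul_le_mul_of_nonneg_left h3 ha).trans (le_of_eq ?_)
      ring
    exact le_of_mul_le_mul_left h5 hk
  refine sub_eq_zero.1 (abs_eq_zero.1 (le_antisymm ?_ (abs_nonneg _)))
  have hlim : Filter.Tendsto (fun η : ℝ => η * (a * b)) (nhdsWithin 0 (Set.Ioi 0)) (nhds 0) := by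
    have : Continuous fun η : ℝ => η * (a * b) := by fun_prop
    simpa using (this.tendsto 0).mono_left (nhdsWithin_le_nhds (s := Set.Ioi 0))
  exact ge_of_tendsto hlim (by filter_upwards [self_mem_nhdsWithin] with η h using key η h)

/-- The spherical measure, as a measure on the ambient space. -/
def sphereMeasure (V : Type*) [NormedAddCommGroup V] [InnerProductSpace ℝ V]
    [FiniteDimensional ℝ V] [MeasurableSpace V] [BorelSpace V] : Measure V :=
  (volume : Measure V).toSphere.map Subtype.val

instance : IsFiniteMeasure (sphereMeasure V) := by
  unfold sphereMeasure
  infer_instance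

theorem ae_sphereMeasure : ∀ᵐ x ∂sphereMeasure V, ‖x‖ = 1 := by
  rw [sphereMeasure, ae_map_iff measurable_subtype_coe.aemeasurable
    (isClosed_eq continuous_norm continuous_const).measurableSet]
  exact Filter.Eventually.of_forall fun x => norm_eq_of_mem_sphere x

theorem integral_sphereMeasure {g : V → ℝ} (hg : Continuous g) :
    ∫ v, g v ∂sphereMeasure V =
      ∫ v : Metric.sphere (0 : V) 1, g v ∂(volume : Measure V).toSphere :=
  integral_map measurable_subtype_coe.aemeasurable hg.aestronglyMeasurable

/-- `toSphere` measures a set through the volume of the cone over it, and an isometry carries cones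
to cones. -/
theorem measurePreserving_sphereMeasure (U : V ≃ₗᵢ[ℝ] V) :
    MeasurePreserving U (sphereMeasure V) (sphereMeasure V) := by
  refine ⟨U.continuous.measurable, Measure.ext fun B hB => ?_⟩
  have hUm : Measurable U := U.continuous.measurable
  have hval : Measurable (Subtype.val : Metric.sphere (0 : V) 1 → V) := measurable_subtype_coe
  rw [Measure.map_apply hUm hB, sphereMeasure, Measure.map_apply hval (hUm hB),
    Measure.map_apply hval hB, Measure.toSphere_apply' _ (hval (hUm hB)),
    Measure.toSphere_apply' _ (hval hB)]
  congr 1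
  rw [← U.measurePreserving.measure_preimage_emb U.toHomeomorph.measurableEmbedding
    (Set.Ioo (0 : ℝ) 1 • Subtype.val '' (Subtype.val ⁻¹' B : Set (Metric.sphere (0 : V) 1)))]
  congr 1
  ext x
  simp only [Set.mem_smul, Set.mem_preimage, Set.mem_image]
  constructor
  · rintro ⟨t, ht, _, ⟨v, hv, rfl⟩, rfl⟩
    exact ⟨t, ht, U v, ⟨⟨U v, by simp⟩, hv, rfl⟩, (map_smul U t _).symm⟩
  · rintro ⟨t, ht, _, ⟨v, hv, rfl⟩, hx⟩
    refine ⟨t, ht, U.symm v, ⟨⟨U.symm v, by simp⟩, by simpa using hv, rfl⟩, ?_⟩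
    apply U.injective
    rw [map_smul, U.apply_symm_apply]
    exact hx

end invariantMeasure

/-! ### Rotation equivariant fields -/

section equivariant

variable {n m : ℕ} {p : ℝ} {Q : ConvexBody (E m)} {r R : ℝ}

/-- The distribution of the direction of `G`, weighted by `‖G‖^p`. -/
def directionMeasure (p : ℝ) (G : E n → E n) : Measure (E n) :=
  (volume.withDensity fun x => ENNReal.ofReal (‖G x‖ ^ p)).map fun x => ‖G x‖⁻¹ • G x

theorem measurable_direction {G : E n → E n} (hG : Measurable G) :
    Measurable fun x => ‖G x‖⁻¹ • G x := hG.norm.inv.smul hG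

theorem measurable_density {G : E n → E n} (hG : Measurable G) :
    Measurable fun x => ENNReal.ofReal (‖G x‖ ^ p) :=
  (hG.norm.pow_const p).ennreal_ofReal

theorem integrable_norm_rpow_field (hp : 1 < p) {G : E n → E n}
    (hG : MemLp G (ENNReal.ofReal p) volume) : Integrable (fun x => ‖G x‖ ^ p) volume := by
  have := hG.integrable_norm_rpow (by simp; linarith) ENNReal.ofReal_ne_top
  rwa [ENNReal.toReal_ofReal (by linarith)] at this

theorem isFiniteMeasure_directionMeasure (hp : 1 < p) {G : E n → E n}
    (hG : MemLp G (ENNReal.ofReal p) volume) : IsFiniteMeasure (directionMeasure p G) := by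
  have : IsFiniteMeasure (volume.withDensity fun x => ENNReal.ofReal (‖G x‖ ^ p)) :=
    isFiniteMeasure_withDensity (integrable_norm_rpow_field hp hG).lintegral_lt_top.ne
  unfold directionMeasure
  infer_instance

theorem directionMeasure_apply {G : E n → E n} (hG : Measurable G) {B : Set (E n)}
    (hB : MeasurableSet B) : directionMeasure p G B =
      ∫⁻ x, B.indicator (fun _ => ENNReal.ofReal (‖G x‖ ^ p)) (‖G x‖⁻¹ • G x) := by
  have hB' := measurable_direction hG hB
  rw [directionMeasure, Measure.map_apply (measurable_direction hG) hB, withDensity_apply _ hB',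
    ← lintegral_indicator hB']
  rfl

/-- Where G = 0 the normalised vector is 0 rather than a unit vector, but the weight 0^p = 0
discards these points. -/
theorem ae_directionMeasure (hp : 1 < p) {G : E n → E n} (hG : Measurable G) :
    ∀ᵐ x ∂directionMeasure p G, ‖x‖ = 1 := by
  rw [directionMeasure, ae_map_iff (measurable_direction hG).aemeasurable
    (isClosed_eq continuous_norm continuous_const).measurableSet,
    ae_withDensity_iff (measurable_density hG)]
  refine Filter.Eventually.of_forall fun x hx => ?_
  have h0 : ‖G x‖ ≠ 0 := fun h0 => hx (by
    rw [h0, Real.zero_rpow (by linarith), ENNReal.ofReal_zero])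
  rw [norm_smul, norm_inv, norm_norm, inv_mul_cancel₀ h0]

theorem measurePreserving_directionMeasure {G : E n → E n} (hG : Measurable G)
    (hU : ∀ U : E n ≃ₗᵢ[ℝ] E n, ∀ᵐ x, G (U x) = U (G x)) (U : E n ≃ₗᵢ[ℝ] E n) :
    MeasurePreserving U (directionMeasure p G) (directionMeasure p G) := by
  have hUm : Measurable U := U.continuous.measurable
  refine ⟨hUm, Measure.ext fun B hB => ?_⟩
  rw [Measure.map_apply hUm hB, directionMeasure_apply hG (hUm hB), directionMeasure_apply hG hB,
    ← U.measurePreserving.lintegral_comp_emb U.toHomeomorph.measurableEmbedding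
      fun x => B.indicator (fun _ => ENNReal.ofReal (‖G x‖ ^ p)) (‖G x‖⁻¹ • G x)]
  refine lintegral_congr_ae ?_
  filter_upwards [hU U] with x hx
  rw [hx, U.norm_map, ← map_smul]
  rfl

theorem integral_directionMeasure {G : E n → E n} (hG : Measurable G) {g : E n → ℝ}
    (hg : Continuous g) : ∫ v, g v ∂directionMeasure p G =
      ∫ x, ‖G x‖ ^ p * g (‖G x‖⁻¹ • G x) := by
  rw [directionMeasure, integral_map (measurable_direction hG).aemeasurable
    hg.aestronglyMeasurable, integral_withDensity_eq_integral_toReal_smul (measurable_density hG)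
    (Filter.Eventually.of_forall fun _ => ENNReal.ofReal_lt_top)]
  refine integral_congr_ae (Filter.Eventually.of_forall fun x => ?_)
  simp only [smul_eq_mul]
  rw [ENNReal.toReal_ofReal (Real.rpow_nonneg (norm_nonneg _) _)]

/-- Averaging over rotations: the integral of a homogeneous function of a rotation equivariant
field. -/
theorem integral_comp_equivariant (hp : 1 < p) {G : E n → E n}
    (hG : MemLp G (ENNReal.ofReal p) volume)
    (hU : ∀ U : E n ≃ₗᵢ[ℝ] E n, ∀ᵐ x, G (U x) = U (G x)) {g : E n → ℝ} (hg : Continuous g)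
    (hg' : ∀ (c : ℝ) v, 0 ≤ c → g (c • v) = c ^ p * g v) :
    (sphereMeasure (E n)).real Set.univ * ∫ x, g (G x) =
      (∫ x, ‖G x‖ ^ p) * ∫ v, g v ∂sphereMeasure (E n) := by
  -- Pass to a measurable representative; equivariance survives because isometries preserve null
  -- sets.
  have hae := hG.1.aemeasurable.ae_eq_mk
  set G' := hG.1.aemeasurable.mk G
  have hGm : Measurable G' := hG.1.aemeasurable.measurable_mk
  have hGp : MemLp G' (ENNReal.ofReal p) volume := hG.ae_eq hae
  have hU' : ∀ U : E n ≃ₗᵢ[ℝ] E n, ∀ᵐ x, G' (U x) = U (G' x) := fun U => by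
    filter_upwards [hU U, hae, U.measurePreserving.quasiMeasurePreserving.ae hae] with x h1 h2 h3
    rw [← h3, ← h2, h1]
  have := isFiniteMeasure_directionMeasure hp hGp
  have h1 := integral_eq_of_invariant (ae_directionMeasure hp hGm) ae_sphereMeasure
    (measurePreserving_directionMeasure hGm hU') measurePreserving_sphereMeasure hg
  have h2 : ∀ x, ‖G' x‖ ^ p * g (‖G' x‖⁻¹ • G' x) = g (G' x) := fun x => by
    rw [← hg' _ _ (norm_nonneg _)]
    rcases eq_or_ne (G' x) 0 with h0 | h0
    · simp [h0]
    · rw [smul_inv_smul₀ (norm_ne_zero_iff.2 h0)]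
  have h3 : (directionMeasure p G').real Set.univ = ∫ x, ‖G' x‖ ^ p := by
    have := integral_directionMeasure (p := p) hGm (continuous_const (y := (1 : ℝ)))
    simpa using this
  rw [integral_directionMeasure hGm hg, h3] at h1
  simp_rw [h2] at h1
  rw [integral_congr_ae (g := fun x => g (G' x)) (by filter_upwards [hae] with x hx; rw [hx]), h1]
  congr 1
  refine integral_congr_ae ?_
  filter_upwards [hae] with x hx
  rw [hx]

theorem adjEquiv_isometry (U : E n ≃ₗᵢ[ℝ] E n) (x : E n) :
    adjEquiv U.toContinuousLinearEquiv x = U.symm x :=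
  ext_inner_right ℝ fun y => by
    rw [inner_adjEquiv_left, ← U.symm.inner_map_map]
    simp

/-- Both ∇f and Uᵗ∇f(U ·) are weak gradients of f, and the adjoint of U is its inverse. -/
theorem weakGrad_equivariant {f : E n → ℝ} (hf : HasWeakGradient f (weakGrad f))
    (U : E n ≃ₗᵢ[ℝ] E n) (hfU : (fun x => f (U x)) =ᵐ[volume] f) :
    ∀ᵐ x, weakGrad f (U x) = U (weakGrad f x) := by
  have h1 := (hf.comp_equiv U.toContinuousLinearEquiv U.measurePreserving).congr hfU
  filter_upwards [hf.ae_eq h1] with x hx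
  rw [hx, adjEquiv_isometry, U.apply_symm_apply]
  rfl

theorem sphereMeasure_real_univ :
    (sphereMeasure (E n)).real Set.univ = n * volume.real (Metric.closedBall (0 : E n) 1) := by
  have h1 : (sphereMeasure (E n)).real Set.univ =
      ((volume : Measure (E n)).toSphere).real Set.univ := by
    rw [Measure.real, sphereMeasure, Measure.map_apply measurable_subtype_coe MeasurableSet.univ,
      Set.preimage_univ, Measure.real]
  rw [h1, Measure.toSphere_real_apply_univ, finrank_euclideanSpace_fin, Measure.real,
    Measure.real, Measure.addHaar_unitClosedBall_eq_addHaar_unitBall]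

end equivariant

/-! ### Radial functions -/

section radial

variable {n m : ℕ} {p : ℝ} {Q : ConvexBody (E m)} {r R : ℝ}

/-- `∫_{g ≤ 1} g^p` for a homogeneous function `g`. -/
theorem setIntegral_rpow_of_homogeneous (hn : 0 < n) (hm : 0 < m) (hp : 1 < p) {g : Mat n m → ℝ}
    (hg : Continuous g) (hg0 : ∀ θ, 0 ≤ g θ) (hgs : ∀ (c : ℝ) θ, 0 ≤ c → g (c • θ) = c * g θ)
    (hL : Bornology.IsBounded {θ | g θ ≤ 1}) :
    ∫ θ in {θ | g θ ≤ 1}, g θ ^ p = volume.real {θ | g θ ≤ 1} * (n * m / (n * m + p)) := by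
  set L := {θ | g θ ≤ 1}
  have hp0 : 0 < p := by linarith
  have hLm : MeasurableSet L := (isClosed_le hg continuous_const).measurableSet
  have : IsFiniteMeasure (volume.restrict L) :=
    ⟨by rw [Measure.restrict_apply_univ]; exact hL.measure_lt_top⟩
  have hgp : Continuous fun θ => g θ ^ p := hg.rpow_const fun _ => Or.inr hp0.le
  have hint : Integrable (fun θ => g θ ^ p) (volume.restrict L) := by
    refine Integrable.of_bound hgp.aestronglyMeasurable 1 ?_
    filter_upwards [ae_restrict_mem hLm] with θ hθ
    rw [Real.norm_of_nonneg (Real.rpow_nonneg (hg0 θ) _)]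
    exact Real.rpow_le_one (hg0 θ) hθ hp0.le
  -- Layer cake: the sublevel set {g^p ≤ t} is t^(1/p) L, which has volume t^(nm/p) |L|.
  have hlevel : ∀ t : ℝ, 0 < t → t ≤ 1 → (volume.restrict L).real {θ | t < g θ ^ p} =
      volume.real L * (1 - t ^ (n * m / p : ℝ)) := fun t ht ht1 => by
    have hset : {θ | t < g θ ^ p}ᶜ = (fun θ => (t ^ (1 / p))⁻¹ • θ) ⁻¹' L := by
      ext θ
      have hpos : 0 < t ^ (1 / p) := Real.rpow_pos_of_pos ht _
      change ¬ (t < g θ ^ p) ↔ g ((t ^ (1 / p))⁻¹ • θ) ≤ 1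
      rw [hgs _ _ (inv_nonneg.2 hpos.le), inv_mul_le_iff₀ hpos, mul_one, not_lt, one_div]
      exact (Real.le_rpow_inv_iff_of_pos (hg0 θ) ht.le hp0).symm
    have hmeas : MeasurableSet {θ | t < g θ ^ p} := measurableSet_lt measurable_const hgp.measurable
    have hsub : (fun θ => (t ^ (1 / p))⁻¹ • θ) ⁻¹' L ⊆ L := by
      rw [← hset]
      intro θ hθ
      have h1 : g θ ^ p ≤ t := not_lt.1 hθ
      by_contra hcon
      have h2 : 1 < g θ := not_le.1 hcon
      linarith [Real.one_lt_rpow h2 hp0]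
    have h1 := measureReal_compl (μ := volume.restrict L) hmeas.compl
    rw [compl_compl] at h1
    rw [h1, measureReal_restrict_apply_univ, hset,
      measureReal_restrict_apply (by rw [← hset]; exact hmeas.compl),
      Set.inter_eq_left.2 hsub, volume_real_preimage_smul (by positivity), inv_pow, inv_inv,
      ← Real.rpow_natCast, ← Real.rpow_mul ht.le, Nat.cast_mul]
    ring_nf
  have hnm : (0 : ℝ) < n * m := by positivity
  rw [hint.integral_eq_integral_meas_lt (Filter.Eventually.of_forall fun θ =>
    Real.rpow_nonneg (hg0 θ) _)]
  have hzero : ∀ t ∈ Set.Ioi (0 : ℝ) \ Set.Ioc 0 1,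
      (volume.restrict L).real {θ | t < g θ ^ p} = 0 := fun t ht => by
    have ht1 : 1 < t := by
      by_contra hcon
      exact ht.2 ⟨ht.1, not_lt.1 hcon⟩
    have hmeas : MeasurableSet {θ | t < g θ ^ p} := measurableSet_lt measurable_const hgp.measurable
    rw [measureReal_restrict_apply hmeas]
    have : {θ | t < g θ ^ p} ∩ L = ∅ := by
      refine Set.eq_empty_of_forall_notMem fun θ hθ => ?_
      have h1 : g θ ^ p ≤ 1 := Real.rpow_le_one (hg0 θ) hθ.2 hp0.le
      have h2 : t < g θ ^ p := hθ.1
      linarith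
    rw [this, measureReal_empty]
  rw [setIntegral_eq_of_subset_of_forall_sdiff_eq_zero measurableSet_Ioi
    Set.Ioc_subset_Ioi_self hzero, setIntegral_congr_fun measurableSet_Ioc
    fun t ht => hlevel t ht.1 ht.2, ← intervalIntegral.integral_of_le zero_le_one,
    intervalIntegral.integral_const_mul, intervalIntegral.integral_sub
    intervalIntegrable_const (intervalIntegral.intervalIntegrable_rpow' (by
      have : (0 : ℝ) < n * m / p := by positivity
      linarith)), integral_rpow (Or.inl (by
      have : (0 : ℝ) < n * m / p := by positivity
      linarith))]
  rw [Real.one_rpow, Real.zero_rpow (by positivity)]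
  simp only [intervalIntegral.integral_const, sub_zero, smul_eq_mul, mul_one]
  congr 1
  field_simp
  ring

end radial

/-! ### L_{Q,p,f} for rotation invariant f, and the usual p-Laplacian -/

section radialLaplacian

variable {n m : ℕ} {p : ℝ} {Q : ConvexBody (E m)} {r R : ℝ}

theorem continuous_supportFn_tmul_rpow (hh : IsNormLike (supportFn (Q : Set (E m))) r R)
    (hp : 1 < p) : Continuous fun q : Mat n m × E n =>
      supportFn (Q : Set (E m)) (tmul q.1 q.2) ^ p :=
  (hh.continuous.comp (((tmulCLM n m).continuous.comp continuous_fst).clm_apply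
    continuous_snd)).rpow_const fun _ => Or.inr (by linarith)

theorem continuous_supportFn_tmul_rpow_right
    (hh : IsNormLike (supportFn (Q : Set (E m))) r R) (hp : 1 < p) (θ : Mat n m) :
    Continuous fun v => supportFn (Q : Set (E m)) (tmul θ v) ^ p :=
  (hh.continuous.comp (tmulCLM n m θ).continuous).rpow_const fun _ => Or.inr (by linarith)

theorem integral_supportFn_rpow_nonneg (hh : IsNormLike (supportFn (Q : Set (E m))) r R)
    {X : Type*} [MeasurableSpace X] (μ : Measure X) (u : X → E m) (p : ℝ) :
    0 ≤ ∫ x, supportFn (Q : Set (E m)) (u x) ^ p ∂μ :=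
  integral_nonneg fun x => Real.rpow_nonneg (hh.apply_nonneg (u x)) p

theorem supportFn_tmul_smul_rpow (hh : IsNormLike (supportFn (Q : Set (E m))) r R) (θ : Mat n m)
    {c : ℝ} (hc : 0 ≤ c) (v : E n) : supportFn (Q : Set (E m)) (tmul θ (c • v)) ^ p =
      c ^ p * supportFn (Q : Set (E m)) (tmul θ v) ^ p := by
  have h1 : tmul θ (c • v) = c • tmul θ v := (tmulCLM n m θ).map_smul c v
  rw [h1, hh.smul _ _ hc, Real.mul_rpow hc (hh.apply_nonneg _)]

theorem gaugePolarBall_rpow (hh : IsNormLike (supportFn (Q : Set (E m))) r R) (hp : 1 < p)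
    (θ : Mat n m) : gaugePolarBall n Q p θ ^ p =
      ∫ v, supportFn (Q : Set (E m)) (tmul θ v) ^ p ∂sphereMeasure (E n) := by
  rw [integral_sphereMeasure (g := fun v => supportFn (Q : Set (E m)) (tmul θ v) ^ p)
    (continuous_supportFn_tmul_rpow_right hh hp θ),
    gaugePolarBall, ← Real.rpow_mul (integral_supportFn_rpow_nonneg hh _ _ _),
    one_div_mul_cancel (by linarith), Real.rpow_one]

theorem gaugePolarBall_nonneg (hh : IsNormLike (supportFn (Q : Set (E m))) r R)
    (θ : Mat n m) : 0 ≤ gaugePolarBall n Q p θ := by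
  rw [gaugePolarBall]
  exact Real.rpow_nonneg (integral_supportFn_rpow_nonneg hh _ _ _) _

theorem volume_closedBall_pos : 0 < volume.real (Metric.closedBall (0 : E n) 1) :=
  ENNReal.toReal_pos (Metric.measure_closedBall_pos volume _ one_pos).ne'
    measure_closedBall_lt_top.ne

/-- For a rotation invariant function, `Π°_{Q,p} f` is a dilate of `Π°_{Q,p} B`. -/
theorem exists_gaugePolarFun_eq_mul (hn : 0 < n) (hm : 0 < m)
    (hh : IsNormLike (supportFn (Q : Set (E m))) r R) (hp : 1 < p) {Ω : Opens (E n)}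
    {f : E n → ℝ} (hf : MemW0 Ω p f) (hΩ : Bornology.IsBounded (Ω : Set (E n)))
    (hf0 : ¬ f =ᵐ[volume] 0)
    (hU : ∀ U : E n ≃ₗᵢ[ℝ] E n, (fun x => f (U x)) =ᵐ[volume] f) :
    ∃ c, 0 < c ∧ ∀ θ : Mat n m, gaugePolarFun Q p f θ = c * gaugePolarBall n Q p θ := by
  have hs : 0 < (sphereMeasure (E n)).real Set.univ := by
    rw [sphereMeasure_real_univ]
    have := volume_closedBall_pos (n := n)
    positivity
  set s := (sphereMeasure (E n)).real Set.univ
  set N := ∫ x, ‖weakGrad f x‖ ^ p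
  have hN : 0 ≤ N := integral_nonneg fun _ => Real.rpow_nonneg (norm_nonneg _) _
  -- The dilation factor comes from averaging over rotations: N is the p-th power of the norm of ∇f
  -- and s the total spherical mass.
  have key : ∀ θ : Mat n m,
      gaugePolarFun Q p f θ = (N / s) ^ (1 / p) * gaugePolarBall n Q p θ := fun θ => by
    have h1 := integral_comp_equivariant hp hf.memLp_weakGrad
      (fun U => weakGrad_equivariant hf.hasWeakGradient U (hU U))
      (g := fun v => supportFn (Q : Set (E m)) (tmul θ v) ^ p)
      (continuous_supportFn_tmul_rpow_right hh hp θ)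
      (fun c v hc => supportFn_tmul_smul_rpow hh θ hc v)
    rw [← gaugePolarBall_rpow hh hp] at h1
    have h2 : ∫ x, supportFn (Q : Set (E m)) (tmul θ (weakGrad f x)) ^ p =
        N / s * gaugePolarBall n Q p θ ^ p := by
      rw [div_mul_eq_mul_div, eq_div_iff hs.ne', mul_comm]
      exact h1
    rw [gaugePolarFun, h2, Real.mul_rpow (by positivity)
      (Real.rpow_nonneg (gaugePolarBall_nonneg hh θ) _),
      ← Real.rpow_mul (gaugePolarBall_nonneg hh θ), mul_one_div_cancel (by linarith),
      Real.rpow_one]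
  refine ⟨_, (Real.rpow_nonneg (div_nonneg hN hs.le) _).lt_of_ne' fun h0 => ?_, key⟩
  have : Nonempty (Fin n × Fin m) := ⟨⟨0, hn⟩, ⟨0, hm⟩⟩
  obtain ⟨θ, hθ⟩ := exists_ne (0 : Mat n m)
  have h1 := gaugePolarFun_pos hh hp hf hΩ hf0 hθ
  rw [key, h0, zero_mul] at h1
  exact h1.false

/-- Fubini: the mean over the sphere of the moments of a set. -/
theorem integral_momentFn (hh : IsNormLike (supportFn (Q : Set (E m))) r R) (hp : 1 < p)
    {L : Set (Mat n m)} (hL : Bornology.IsBounded L) (hLm : MeasurableSet L) :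
    ∫ v, momentFn Q p L v ∂sphereMeasure (E n) = ∫ θ in L, gaugePolarBall n Q p θ ^ p := by
  have : IsFiniteMeasure (volume.restrict L) :=
    ⟨by rw [Measure.restrict_apply_univ]; exact hL.measure_lt_top⟩
  obtain ⟨C, hC⟩ := hL.exists_norm_le
  have hint : Integrable (fun q : E n × Mat n m => supportFn (Q : Set (E m)) (tmul q.2 q.1) ^ p)
      ((sphereMeasure (E n)).prod (volume.restrict L)) := by
    refine Integrable.of_bound ((continuous_supportFn_tmul_rpow hh hp).comp
      continuous_swap).aestronglyMeasurable ((R * (C * 1)) ^ p) ?_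
    filter_upwards [Measure.quasiMeasurePreserving_fst.ae (ae_sphereMeasure (V := E n)),
      Measure.quasiMeasurePreserving_snd.ae (ae_restrict_mem hLm)] with q hq1 hq2
    rw [Real.norm_of_nonneg (Real.rpow_nonneg (hh.apply_nonneg _) _)]
    refine Real.rpow_le_rpow (hh.apply_nonneg _) ((hh.ge _).trans
      (mul_le_mul_of_nonneg_left ?_ hh.nonneg)) (by linarith)
    refine (norm_tmul_le _ _).trans ?_
    rw [hq1]
    exact mul_le_mul_of_nonneg_right (hC _ hq2) zero_le_one
  simp_rw [momentFn_eq, gaugePolarBall_rpow hh hp]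
  exact integral_integral_swap (f := fun (v : E n) (θ : Mat n m) =>
    supportFn (Q : Set (E m)) (tmul θ v) ^ p) hint

/-- Rotate v onto ‖v‖ • e and use p-homogeneity. -/
theorem momentFn_eq_of_invariant (hh : IsNormLike (supportFn (Q : Set (E m))) r R)
    {L : Set (Mat n m)} (hL : ∀ U : E n ≃ₗᵢ[ℝ] E n, leftMul m U.toContinuousLinearEquiv ⁻¹' L = L)
    {e : E n} (he : ‖e‖ = 1) (v : E n) : momentFn Q p L v = ‖v‖ ^ p * momentFn Q p L e := by
  obtain ⟨U, hU⟩ := exists_isometry_apply_eq (u := v) (w := ‖v‖ • e) (by simp [norm_smul, he])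
  have h1 := momentFn_preimage_leftMul (Q := Q) (p := p) U.toContinuousLinearEquiv
    (measurePreserving_leftMul_isometry U) L (‖v‖ • e)
  rw [hL, adjEquiv_isometry, ← hU, U.symm_apply_apply, hU, momentFn_smul hh (norm_nonneg v)] at h1
  exact h1

/-- For a rotation invariant function, `L_{Q,p,f}` is the Euclidean unit ball. -/
theorem supportFn_bodyL_of_invariant (hn : 0 < n) (hm : 0 < m)
    (hh : IsNormLike (supportFn (Q : Set (E m))) r R) (hp : 1 < p) {Ω : Opens (E n)}
    {f : E n → ℝ} (hf : MemW0 Ω p f) (hΩ : Bornology.IsBounded (Ω : Set (E n)))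
    (hf0 : ¬ f =ᵐ[volume] 0)
    (hU : ∀ U : E n ≃ₗᵢ[ℝ] E n, (fun x => f (U x)) =ᵐ[volume] f) (v : E n) :
    supportFn (bodyL Q p f) v = ‖v‖ := by
  have hp0 : 0 < p := by linarith
  obtain ⟨c, hc, hcg⟩ := exists_gaugePolarFun_eq_mul hn hm hh hp hf hΩ hf0 hU
  have hV := volume_real_polarFun_pos hh hp hf hΩ hf0
  have hLb := isBounded_polarFun hh hp hf hΩ hf0
  have hLm := (isClosed_polarFun hh hp hf).measurableSet
  have hω := volume_closedBall_pos (n := n)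
  have hn' : (0 : ℝ) < n := by exact_mod_cast hn
  have hm' : (0 : ℝ) < m := by exact_mod_cast hm
  have hball : (polarBall n Q p : Set (Mat n m)) = (fun θ => c⁻¹ • θ) ⁻¹' polarFun Q p f := by
    ext θ
    change gaugePolarBall n Q p θ ≤ 1 ↔ gaugePolarFun Q p f (c⁻¹ • θ) ≤ 1
    rw [gaugePolarFun_smul hh hp f (by positivity), hcg, inv_mul_cancel_left₀ hc.ne']
  -- Π°B = c Π°f, so the volume ratio is c^(nm), and its root of order nm is c.
  have hcoef : coefL Q p f =
      (m / ((n * m + p) * volume.real (Metric.closedBall (0 : E n) 1))) ^ (-(1 / p)) * c := by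
    rw [coefL, hball, volume_real_preimage_smul (by positivity), mul_div_assoc,
      div_self hV.ne', mul_one, inv_pow, inv_inv, ← Real.rpow_natCast, ← Real.rpow_mul hc.le,
      Nat.cast_mul, mul_one_div_cancel (by positivity), Real.rpow_one]
  have hinv : ∀ U : E n ≃ₗᵢ[ℝ] E n,
      leftMul m U.toContinuousLinearEquiv ⁻¹' polarFun Q p f = polarFun Q p f := fun U => by
    have h1 := hf.hasWeakGradient.comp_equiv U.toContinuousLinearEquiv U.measurePreserving
    have h2 := (h1.congr (hU U)).weakGrad_ae_eq.trans h1.weakGrad_ae_eq.symm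
    rw [← hf.hasWeakGradient.polarFun_comp U.toContinuousLinearEquiv U.measurePreserving]
    ext θ
    change gaugePolarFun Q p (fun x => f (U x)) θ ≤ 1 ↔ gaugePolarFun Q p f θ ≤ 1
    rw [gaugePolarFun_congr h2]
    rfl
  have : Nonempty (Fin n) := ⟨⟨0, hn⟩⟩
  obtain ⟨e, he⟩ := NormedSpace.sphere_nonempty (E := E n) (x := 0) (r := 1) |>.2 zero_le_one
  have he1 : ‖e‖ = 1 := by simpa using he
  have hmom := momentFn_eq_of_invariant (p := p) hh hinv he1
  set V := volume.real (polarFun Q p f : Set (Mat n m))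
  set K := momentFn Q p (polarFun Q p f : Set (Mat n m)) e
  set ω := volume.real (Metric.closedBall (0 : E n) 1)
  -- Integrate the moment over the sphere in two ways: as a constant times the total mass nω, and by
  -- Fubini as the integral of the p-th power of the gauge of Π°B, which is c⁻¹ times the gauge of
  -- Π°f.
  have hK : n * ω * K = (c ^ p)⁻¹ * (V * (n * m / (n * m + p))) := by
    have h1 := integral_momentFn (n := n) hh hp hLb hLm
    have h2 : ∫ v, momentFn Q p (polarFun Q p f) v ∂sphereMeasure (E n) = n * ω * K := by
      rw [integral_congr_ae (g := fun _ => K), integral_const, sphereMeasure_real_univ,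
        smul_eq_mul]
      filter_upwards [ae_sphereMeasure (V := E n)] with v hv
      rw [hmom, hv, Real.one_rpow, one_mul]
    have h3 : ∀ θ : Mat n m, gaugePolarBall n Q p θ ^ p =
        (c ^ p)⁻¹ * gaugePolarFun Q p f θ ^ p := fun θ => by
      rw [hcg, Real.mul_rpow hc.le (gaugePolarBall_nonneg hh θ),
        inv_mul_cancel_left₀ (by positivity)]
    rw [h2] at h1
    simp_rw [h3] at h1
    rw [h1, integral_const_mul]
    congr 1
    exact setIntegral_rpow_of_homogeneous hn hm hp (continuous_gaugePolarFun hh hp hf)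
      (gaugePolarFun_nonneg hh f) (fun c θ hc => gaugePolarFun_smul hh hp f hc θ) hLb
  have hK' : V⁻¹ * (‖v‖ ^ p * K) = (m / ((n * m + p) * ω)) * ((c⁻¹ * ‖v‖) ^ p) := by
    have hcp : 0 < c ^ p := Real.rpow_pos_of_pos hc _
    have hK2 : K = (c ^ p)⁻¹ * V * (m / ((n * m + p) * ω)) := by
      have h4 : (n : ℝ) * ω ≠ 0 := by positivity
      refine mul_left_cancel₀ h4 (hK.trans ?_)
      field_simp
    rw [hK2, Real.mul_rpow (by positivity) (norm_nonneg v), Real.inv_rpow hc.le]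
    field_simp
  have hq : 0 < m / ((n * m + p) * ω) := by positivity
  rw [supportFn_bodyL hn hm hh hp hf hΩ, hmom, hcoef, hK', Real.mul_rpow hq.le (by positivity),
    ← Real.rpow_mul (by positivity : (0 : ℝ) ≤ c⁻¹ * ‖v‖), mul_one_div_cancel hp0.ne',
    Real.rpow_one, Real.rpow_neg hq.le]
  have hq' : 0 < (m / ((n * m + p) * ω)) ^ (1 / p) := Real.rpow_pos_of_pos hq _
  field_simp

theorem gradient_norm_rpow (hp : 1 < p) (z : E n) :
    gradient (fun w : E n => 1 / p * ‖w‖ ^ p) z = ‖z‖ ^ (p - 2) • z := by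
  rw [gradient_const_mul, gradient, (hasFDerivAt_norm_rpow z hp).fderiv]
  refine ext_inner_right ℝ fun y => ?_
  rw [inner_smul_left, InnerProductSpace.toDual_symm_apply, inner_smul_left]
  simp only [FunLike.coe_smul, Pi.smul_apply, innerSL_apply_apply, smul_eq_mul,
    conj_trivial]
  have : p ≠ 0 := by linarith
  field_simp

theorem affineLaplacian_eq_pLaplacian (hn : 0 < n) (hm : 0 < m)
    (hQ : IsSmoothBody n Q) (hp : 1 < p) {Ω : Opens (E n)} {f : E n → ℝ} (hf : MemW0 Ω p f)
    (hΩ : Bornology.IsBounded (Ω : Set (E n)))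
    (hU : ∀ U : E n ≃ₗᵢ[ℝ] E n, (fun x => f (U x)) =ᵐ[volume] f) :
    affineLaplacian Q p f = pLaplacian p f := by
  obtain ⟨r, R, hh⟩ := exists_isNormLike_supportFn hQ.zero_mem_interior
  -- For f = 0 the body is not the unit ball, so the fields are compared directly: both vanish where
  -- ∇f = 0, the Wulff field by its growth bound.
  by_cases hf0 : f =ᵐ[volume] 0
  · ext φ
    have hG := hf.weakGrad_ae_eq_zero hf0
    have hloc : LocallyIntegrable (fun x => ‖weakGrad f x‖ ^ (p - 2) • weakGrad f x)
        (volume : Measure (E n)) := by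
      refine locallyIntegrable_zero.congr ?_
      filter_upwards [hG] with x hx
      simp [hx]
    rw [affineLaplacian_apply hn hm hQ hp hf hΩ, pLaplacian, negDiv_apply hloc]
    have hz : wulffField p (bodyL Q p f) 0 = 0 := by
      obtain ⟨-, C, hC⟩ := differentiable_potential_bodyL hn hm hQ hp hf hΩ
      have := hC 0
      rw [norm_zero, Real.zero_rpow (by linarith), mul_zero] at this
      exact norm_le_zero_iff.1 this
    refine integral_congr_ae ?_
    filter_upwards [hG] with x hx
    rw [hx, Pi.zero_apply, hz, smul_zero]
  · rw [affineLaplacian, wulffLaplacian, pLaplacian]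
    congr 1
    ext1 x
    simp only [wulffField, supportFn_bodyL_of_invariant hn hm hh hp hf hΩ hf0 hU]
    exact gradient_norm_rpow hp _

end radialLaplacian

end AffineLap

end

/-! ### Specialisation to SL(n) and to radial functions -/

theorem proposition3p1 {n m : ℕ} (hn : 0 < n) (hm : 0 < m) {p : ℝ} (hp : 1 < p)
    (Q : ConvexBody (AffineLap.E m)) (hQ : AffineLap.IsSmoothBody n Q)
    (Ω : TopologicalSpace.Opens (AffineLap.E n))
    (hΩ : Bornology.IsBounded (Ω : Set (AffineLap.E n)))
    (A : Matrix.SpecialLinearGroup (Fin n) ℝ) (f : AffineLap.E n → ℝ)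
    (hf : AffineLap.MemW0 Ω p f) (a : ℝ) (ha : 0 < a) :
    -- the operator is well defined at `f`: `h_L^p / p` is differentiable for `L = L_{Q,p,f}`, and
    -- the field `∇(h_L^p / p)(∇f)` is in `L^{p/(p-1)}`
    (Differentiable ℝ
        (fun z => 1 / p * AffineLap.supportFn (AffineLap.bodyL Q p f) z ^ p) ∧
      MemLp (fun x => AffineLap.wulffField p (AffineLap.bodyL Q p f) (AffineLap.weakGrad f x))
        (ENNReal.ofReal (p / (p - 1))) volume) ∧
    -- (a)
    (AffineLap.MemW0 (AffineLap.slPreimage A Ω) p (fun x => f (AffineLap.slMap A x)) ∧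
      ∀ φ, AffineLap.affineLaplacian Q p (fun x => f (AffineLap.slMap A x)) φ =
        AffineLap.distComp (AffineLap.affineLaplacian Q p f) A φ) ∧
    -- (b)
    (AffineLap.MemW0 Ω p (fun x => a * f x) ∧
      AffineLap.affineLaplacian Q p (fun x => a * f x) =
        a ^ (p - 1) • AffineLap.affineLaplacian Q p f) ∧
    -- (c)
    ((∃ F : ℝ → ℝ, ∀ᵐ x, f x = F ‖x‖) →
      AffineLap.affineLaplacian Q p f = AffineLap.pLaplacian p f) := by
  have hT := AffineLap.measurePreserving_slEquiv A
  have hTΩ : ∀ x, AffineLap.slEquiv A x ∈ Ω → x ∈ AffineLap.slPreimage A Ω := fun _ h => h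
  have hΩ' : Bornology.IsBounded (AffineLap.slPreimage A Ω : Set (AffineLap.E n)) := by
    have h1 : (AffineLap.slPreimage A Ω : Set (AffineLap.E n)) ⊆
        AffineLap.slMap A⁻¹ '' (Ω : Set (AffineLap.E n)) := fun x hx =>
      ⟨AffineLap.slMap A x, hx, AffineLap.slMap_inv_apply A x⟩
    exact ((AffineLap.slMap A⁻¹).lipschitz.isBounded_image hΩ).subset h1
  refine ⟨⟨(AffineLap.differentiable_potential_bodyL hn hm hQ hp hf hΩ).1,
      AffineLap.memLp_wulffField_bodyL hn hm hQ hp hf hΩ⟩,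
    ⟨hf.comp_equiv (AffineLap.slEquiv A) hT hTΩ, fun φ => ?_⟩,
    ⟨hf.const_mul a, hf.affineLaplacian_const_mul hn hm hQ hp hΩ ha⟩, fun hrad => ?_⟩
  · exact hf.affineLaplacian_comp hn hm hQ hp hΩ hΩ' (AffineLap.slEquiv A) hTΩ hT
      (AffineLap.measurePreserving_leftMul_slEquiv A) φ
  · obtain ⟨F, hF⟩ := hrad
    refine AffineLap.affineLaplacian_eq_pLaplacian hn hm hQ hp hf hΩ fun U => ?_
    -- The radial formula holds only a.e., so it is needed both at x and at U x; the latter is again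
    -- an a.e. statement.
    filter_upwards [hF, U.measurePreserving.quasiMeasurePreserving.ae hF] with x h1 h2
    rw [h1, h2, U.norm_map]
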